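/- Let $(\mathcal X,\mathcal A,\nu)$ be a $\sigma$-finite measure space (for instance $\mathbb R$ with Lebesgue measure), let $q$ and $q_\gamma$ ($\gamma>0$) be probability densities with respect to $\nu$, and suppose that $q_\gamma\to q$ $\nu$-a.e. as $\gamma\to\infty$. For every $\gamma>0$ suppose that $q_\gamma\neq q$ on a set of positive $\nu$-measure, that $\log(q_\gamma/q)$ is finite a.s. under both $q$ and $q_\gamma$, and that the Kullback–Leibler divergences $D(q\|q_\gamma)$ and $D(q_\gamma\|q)$ are finite. Let $X_1,X_2,\dots$ be independent observations and $\mathcal F_k=\sigma(X_1,\dots,X_k)$ (with $\mathcal F_0$ trivial). For $t\ge 1$ let $\mathbb E_t$ be the expectation when $X_1,\dots,X_{t-1}$ have density $q$ and $X_t,X_{t+1},\dots$ have density $q_\gamma$, and let $\mathbb E_\infty$ be the expectation when all observations have density $q$. The optimal worst-case average detection delay is $$n(\gamma)=\inf_{T:\ \mathbb E_\infty[T]\ge\gamma}\ \sup_{t\ge1}\ \operatorname{ess\,sup}\ \mathbb E_t\big[(T-t+1)^+\mid\mathcal F_{t-1}\big],$$ the infimum being over all (possibly infinite) stopping times $T$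 of $(\mathcal F_k)$ with $\mathbb E_\infty[T]\ge\gamma$. For $a<0<b$ let $S_k=\sum_{j=1}^k\log\frac{q_\gamma(X_j)}{q(X_j)}$ and $T_{a,b}=\inf\{k\ge1: S_k\notin(a,b)\}$. Suppose that the expected overshoots vanish: for all fixed $a<0<b$ and for $p=q$ as well as $p=q_\gamma$, $$\lim_{\gamma\to\infty}\mathbb E_p\big[S_{T_{a,b}}-b\mid S_{T_{a,b}}\ge b\big]=0,\qquad \lim_{\gamma\to\infty}\mathbb E_p\big[S_{T_{a,b}}-a\mid S_{T_{a,b}}\le a\big]=0,$$ where under $\mathbb E_p$ the observations are i.i.d. with density $p$. Suppose also that $D(q\|q_\gamma)/D(q_\gamma\|q)\to c$ as $\gamma\to\infty$ for some $c>0$. Let $\rho\in(0,1)$, let the damage function be $g(x)=x^\rho$, and let $d(\gamma)=n(\gamma)\,g\big(D(q\|q_\gamma)\big)$ be the total damage. Then $n(\gamma)$ is finite for every $\gamma>0$, and, as $\gamma\to\infty$, the total damage has its largest asymptotic order when $\gamma D(q\|q_\gamma)=\Theta(1)$, in the following sense: 1. $d(\gamma)=O(\gamma^{1-\rho})$ in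 all cases; 2. if $\gamma D(q\|q_\gamma)=\Theta(1)$, then $d(\gamma)=\Theta(\gamma^{1-\rho})$; 3. if $\gamma D(q\|q_\gamma)\to\infty$, then $d(\gamma)=o(\gamma^{1-\rho})$; 4. if $\gamma D(q\|q_\gamma)\to0$, then $d(\gamma)=o(\gamma^{1-\rho})$. -/

import Mathlib

open MeasureTheory ProbabilityTheory Filter Topology Asymptotics
open scoped ENNReal

namespace QuickestChange

noncomputable section

/-- `p` is a probability density function with respect to the reference measure `ν`. -/
structure IsPDF {X : Type*} [MeasurableSpace X] (ν : Measure X) (p : X → ℝ) : Prop where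
  measurable : Measurable p
  nonneg : ∀ x, 0 ≤ p x
  lintegral_eq_one : ∫⁻ x, ENNReal.ofReal (p x) ∂ν = 1

/-- The probability distribution on `X` with density `p` with respect to `ν`. -/
def obsDist {X : Type*} [MeasurableSpace X] (ν : Measure X) (p : X → ℝ) : Measure X :=
  ν.withDensity fun x => ENNReal.ofReal (p x)

/-- The Kullback-Leibler divergence `D(p₁‖p₂)` of two densities, as an extended number. -/
def kl {X : Type*} [MeasurableSpace X] (ν : Measure X) (p₁ p₂ : X → ℝ) : ℝ≥0∞ :=
  InformationTheory.klDiv (obsDist ν p₁) (obsDist ν p₂)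

/-- The law of an i.i.d. sequence with density `p`. On the space `ℕ → X` of sample paths `ω`,
the `k`-th observation, `k ≥ 1`, is `ω (k - 1)`. -/
def iidLaw {X : Type*} [MeasurableSpace X] (ν : Measure X) (p : X → ℝ) : Measure (ℕ → X) :=
  Measure.infinitePi fun _ : ℕ => obsDist ν p

/-- The law of independent observations when the change occurs at time `t`: observations number
`1, …, t - 1` have density `q₀`, observations number `t, t + 1, …` have density `q₁`. -/
def changeLaw {X : Type*} [MeasurableSpace X] (ν : Measure X) (q₀ q₁ : X → ℝ) (t : ℕ) :
    Measure (ℕ → X) :=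
  Measure.infinitePi fun i : ℕ => if i + 1 < t then obsDist ν q₀ else obsDist ν q₁

/-- The filtration of the observations: `obsFiltration X k` is generated by the first `k`
observations (and is trivial for `k = 0`). -/
def obsFiltration (X : Type*) [MeasurableSpace X] :
    Filtration ℕ (MeasurableSpace.pi : MeasurableSpace (ℕ → X)) where
  seq k := ⨆ i : ℕ, ⨆ _ : i < k, MeasurableSpace.comap (fun ω : ℕ → X => ω i) inferInstance
  mono' _ _ hkl := iSup_mono fun _ => iSup_mono' fun hi => ⟨lt_of_lt_of_le hi hkl, le_rfl⟩
  le' _ := iSup_le fun i => iSup_le fun _ => (measurable_pi_apply i).comap_le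

/-- Lorden's worst-case average detection delay
`sup_{t ≥ 1} ess sup E_t[(T - t + 1)⁺ | F_{t-1}]` of an extended stopping time `T`. -/
def worstDelay {X : Type*} [MeasurableSpace X] (ν : Measure X) (q₀ q₁ : X → ℝ)
    (T : (ℕ → X) → ℕ∞) : ℝ≥0∞ :=
  ⨆ t : ℕ, ⨆ _ : 1 ≤ t,
    essSup
      (condLExp (obsFiltration X (t - 1)) (changeLaw ν q₀ q₁ t)
        fun ω => ((T ω + 1 - (t : ℕ∞) : ℕ∞) : ℝ≥0∞))
      (changeLaw ν q₀ q₁ t)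

/-- The optimal worst-case average detection delay `n(γ)`: the infimum of `worstDelay` over all
extended stopping times `T` whose expectation without a change is at least `γ`. -/
def optDelay {X : Type*} [MeasurableSpace X] (ν : Measure X) (q₀ q₁ : X → ℝ) (γ : ℝ) : ℝ≥0∞ :=
  ⨅ T : (ℕ → X) → ℕ∞, ⨅ _ : IsStoppingTime (obsFiltration X) T ∧
    ENNReal.ofReal γ ≤ ∫⁻ ω, (T ω : ℝ≥0∞) ∂(iidLaw ν q₀), worstDelay ν q₀ q₁ T

/-- The total damage `d(γ) = n(γ) g(D(q‖q_γ))` for the damage function `g`. -/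
def totalDamage {X : Type*} [MeasurableSpace X] (ν : Measure X) (g : ℝ → ℝ)
    (q : X → ℝ) (qf : ℝ → X → ℝ) (γ : ℝ) : ℝ :=
  (optDelay ν q (qf γ) γ).toReal * g (kl ν q (qf γ)).toReal

/-- The log-likelihood ratio random walk `S_k = ∑_{j ≤ k} log (q₁(X_j) / q₀(X_j))`. -/
def llrWalk {X : Type*} (q₀ q₁ : X → ℝ) (k : ℕ) (ω : ℕ → X) : ℝ :=
  ∑ j ∈ Finset.range k, Real.log (q₁ (ω j) / q₀ (ω j))

/-- The SPRT stopping time `T_{a,b} = inf {k ≥ 1 : S_k ∉ (a, b)}`. -/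
def sprtTime {X : Type*} (q₀ q₁ : X → ℝ) (a b : ℝ) : (ℕ → X) → ℕ∞ :=
  hittingAfter (llrWalk q₀ q₁) (Set.Ioo a b)ᶜ 1

/-- The value `S_T` of the walk at `T = T_{a,b}`. For `a < 0 < b`, on the (null) event `T = ∞`
this is some value in `(a, b)`, so that this event meets neither `S_T ≥ b` nor `S_T ≤ a`. -/
def sprtValue {X : Type*} (q₀ q₁ : X → ℝ) (a b : ℝ) : (ℕ → X) → ℝ :=
  stoppedValue (llrWalk q₀ q₁) (sprtTime q₀ q₁ a b)

/-- The elementary conditional expectation `E_P[f | A]` given an event `A`. -/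
def condMean {Ω : Type*} [MeasurableSpace Ω] (P : Measure Ω) (f : Ω → ℝ) (A : Set Ω) : ℝ :=
  ∫ ω, f ω ∂(P[|A])

/-- The expected overshoots vanish, when the observations have density `p γ`: for all fixed
`a < 0 < b`, `E_p[S_T - b | S_T ≥ b] → 0` and `E_p[S_T - a | S_T ≤ a] → 0` as `γ → ∞`. -/
def VanishingOvershoot {X : Type*} [MeasurableSpace X] (ν : Measure X)
    (q : X → ℝ) (qf : ℝ → X → ℝ) (p : ℝ → X → ℝ) : Prop :=
  ∀ a b : ℝ, a < 0 → 0 < b →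
    Tendsto (fun γ : ℝ => condMean (iidLaw ν (p γ)) (fun ω => sprtValue q (qf γ) a b ω - b)
      {ω | b ≤ sprtValue q (qf γ) a b ω}) atTop (𝓝 0) ∧
    Tendsto (fun γ : ℝ => condMean (iidLaw ν (p γ)) (fun ω => sprtValue q (qf γ) a b ω - a)
      {ω | sprtValue q (qf γ) a b ω ≤ a}) atTop (𝓝 0)

end

end QuickestChange

/-! Write D = D(q‖q_γ), D' = D(q_γ‖q) and y = γD. Since γ·D^ρ = y^ρ·γ^(1-ρ), every bound on the
delay becomes γ^(1-ρ) times a function of y.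

Small y: stopping at the deterministic time ⌈γ⌉ gives n(γ) ≤ 2γ for γ ≥ 1, hence damage at most
2·y^ρ·γ^(1-ρ) (`totalDamage_le_of_trivial`). This is bounded for y ≤ 1 and negligible for y → 0.

Large y: a sequential probability ratio test with thresholds ±b, cut off after about 8(b+1)/D'
observations, has level e^(-b) and power at least 1/4; the power comes from Wald's identity and
overshoot at most 1 (`le_iidLaw_sprtAccept`). The alarm is raised when K ≈ log(1+γD')/b consecutive
blocks all accept the change. The mean time to a false alarm is then at least γ, and the delay is at
most a constant times (1+γD')^(log 16/b)/D' (`RegularPair.optDelay_le`). A crude power of y is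
enough: for large b the exponent is at most (1-ρ)/2, and since D/D' → c the damage is
O(y^(-(1-ρ)/2)·γ^(1-ρ)).

Lower bound for bounded y: over m observations with mD ≤ 1/4 the two laws are hard to tell apart, so
a rule with delay at most m/32 also stops without a change, with probability at least 1/2 in every
window of length m (`iidLaw_survival_le`). Its mean is then at most 2m, so n(γ) is of order γ at
least (`le_optDelay`). -/

namespace QuickestChange

/-! ### Sequence space: independence, shifts and change of measure -/

section SequenceSpace

/-- The sequence with its first `s` terms removed. -/
def shift {X : Type*} (s : ℕ) (ω : ℕ → X) : ℕ → X := fun j => ω (j + s)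

lemma shift_zero {X : Type*} : (shift 0 : (ℕ → X) → ℕ → X) = id := rfl

variable {X : Type*} [MeasurableSpace X]

/-- The σ-algebra on the sequence space generated by the coordinates with index in `S`. -/
@[reducible] def coordSigma (X : Type*) [MeasurableSpace X] (S : Set ℕ) : MeasurableSpace (ℕ → X) :=
  ⨆ i ∈ S, MeasurableSpace.comap (fun ω : ℕ → X => ω i) inferInstance

lemma coordSigma_le (S : Set ℕ) : coordSigma X S ≤ MeasurableSpace.pi :=
  iSup₂_le fun i _ => (measurable_pi_apply i).comap_le

lemma coordSigma_mono {S T : Set ℕ} (h : S ⊆ T) : coordSigma X S ≤ coordSigma X T :=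
  biSup_mono h

lemma measurable_coord {S : Set ℕ} {i : ℕ} (hi : i ∈ S) :
    Measurable[coordSigma X S] fun ω : ℕ → X => ω i :=
  measurable_iff_comap_le.2 (le_iSup₂_of_le i hi le_rfl)

lemma measurableSet_obs {k : ℕ} {A : Set (ℕ → X)} (hA : MeasurableSet[obsFiltration X k] A) :
    MeasurableSet A :=
  (obsFiltration X).le k _ hA

lemma indep_coordSigma (μ : ℕ → Measure X) [∀ i, IsProbabilityMeasure (μ i)] {S T : Set ℕ}
    (h : Disjoint S T) : Indep (coordSigma X S) (coordSigma X T) (Measure.infinitePi μ) :=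
  indep_iSup_of_disjoint (fun i => (measurable_pi_apply i).comap_le)
    (iIndepFun_infinitePi (P := μ) (X := fun _ x => x) fun _ => measurable_id) h

lemma infinitePi_inter (μ : ℕ → Measure X) [∀ i, IsProbabilityMeasure (μ i)] {S T : Set ℕ}
    (h : Disjoint S T) {A B : Set (ℕ → X)} (hA : MeasurableSet[coordSigma X S] A)
    (hB : MeasurableSet[coordSigma X T] B) :
    Measure.infinitePi μ (A ∩ B) = Measure.infinitePi μ A * Measure.infinitePi μ B :=
  (Indep_iff _ _ _).1 (indep_coordSigma μ h) A B hA hB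

lemma measurable_shift (s : ℕ) : Measurable (shift s : (ℕ → X) → ℕ → X) :=
  measurable_pi_lambda _ fun _ => measurable_pi_apply _

lemma map_shift_infinitePi (μ : ℕ → Measure X) [∀ i, IsProbabilityMeasure (μ i)] (s : ℕ) :
    (Measure.infinitePi μ).map (shift s) = Measure.infinitePi fun j => μ (j + s) :=
  Measure.map_infinitePi_infinitePi_of_inj (P := μ) (f := fun j => j + s)
    (add_left_injective s)

/-- Locating a shifted event in the window [s, s + k) is what makes it independent of the past and
of other blocks through `infinitePi_inter`. -/
lemma measurableSet_shift_preimage {k s : ℕ} {A : Set (ℕ → X)}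
    (hA : MeasurableSet[obsFiltration X k] A) :
    MeasurableSet[coordSigma X (Set.Ico s (s + k))] (shift s ⁻¹' A) := by
  have h : Measurable[coordSigma X (Set.Ico s (s + k)), obsFiltration X k]
      (shift s : (ℕ → X) → ℕ → X) := by
    rw [measurable_iff_le_map]
    refine iSup₂_le fun i hi => ?_
    rintro _ ⟨B, hB, rfl⟩
    have : i + s ∈ Set.Ico s (s + k) := ⟨by omega, by omega⟩
    exact measurable_coord this hB
  exact h hA

/-- The finite boxes with index set inside `S` form a π-system generating the σ-algebra of these
coordinates. -/
lemma measure_eq_of_eq_on_boxes {P Q : Measure (ℕ → X)} [IsFiniteMeasure P] {S : Set ℕ}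
    (h : ∀ (s : Finset ℕ) (t : ℕ → Set X), (s : Set ℕ) ⊆ S → (∀ i, MeasurableSet (t i)) →
      P (Set.pi s t) = Q (Set.pi s t))
    {A : Set (ℕ → X)} (hA : MeasurableSet[coordSigma X S] A) : P A = Q A := by
  refine ext_on_measurableSpace_of_generate_finite _ _ (fun B hB => ?_) (coordSigma_le S)
    (generateFrom_piiUnionInter_measurableSet _ S).symm
    (isPiSystem_piiUnionInter _
      (fun i => @MeasurableSpace.isPiSystem_measurableSet _
        (MeasurableSpace.comap (fun ω : ℕ → X => ω i) inferInstance)) S) ?_ hA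
  · obtain ⟨s, hs, f, hf, rfl⟩ := hB
    have : ∀ i, ∃ t : Set X, MeasurableSet t ∧ (i ∈ s → (fun ω : ℕ → X => ω i) ⁻¹' t = f i) := by
      intro i
      by_cases hi : i ∈ s
      · obtain ⟨t, ht, h'⟩ := hf i hi
        exact ⟨t, ht, fun _ => h'⟩
      · exact ⟨Set.univ, .univ, fun h => absurd h hi⟩
    choose t ht htf using this
    have e : (⋂ x ∈ s, f x) = Set.pi s t := by
      ext ω
      simp only [Set.mem_iInter, Set.mem_pi, Finset.mem_coe]
      exact forall₂_congr fun i hi => by rw [← htf i hi]; rfl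
    rw [e]
    exact h s t hs ht
  -- The box over the empty index set is the whole space, so the total masses agree.
  · simpa using h ∅ (fun _ => Set.univ) (by simp) (fun _ => .univ)

/-- Product measures with the same marginals on `S` agree on events generated by the coordinates
in `S`. -/
lemma infinitePi_congr_coordSigma {μ ν : ℕ → Measure X} [∀ i, IsProbabilityMeasure (μ i)]
    [∀ i, IsProbabilityMeasure (ν i)] {S : Set ℕ} (h : ∀ i ∈ S, μ i = ν i)
    {A : Set (ℕ → X)} (hA : MeasurableSet[coordSigma X S] A) :
    Measure.infinitePi μ A = Measure.infinitePi ν A := by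
  refine measure_eq_of_eq_on_boxes (fun s t hs ht => ?_) hA
  rw [Measure.infinitePi_pi _ fun i _ => ht i, Measure.infinitePi_pi _ fun i _ => ht i]
  exact Finset.prod_congr rfl fun i hi => by rw [h i (hs hi)]

/-- Change of measure for product measures on events of finite horizon. -/
lemma infinitePi_eq_setLIntegral_prod {μ ν : ℕ → Measure X} [∀ i, IsProbabilityMeasure (μ i)]
    [∀ i, IsProbabilityMeasure (ν i)] {r : ℕ → X → ℝ≥0∞} (hr : ∀ i, Measurable (r i)) {k : ℕ}
    (h : ∀ i < k, ν i = (μ i).withDensity (r i)) {A : Set (ℕ → X)}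
    (hA : MeasurableSet[obsFiltration X k] A) :
    Measure.infinitePi ν A
      = ∫⁻ ω in A, ∏ i ∈ Finset.range k, r i (ω i) ∂(Measure.infinitePi μ) := by
  rw [← withDensity_apply _ (measurableSet_obs hA)]
  refine measure_eq_of_eq_on_boxes (S := Set.Iio k) (fun s t hs ht => ?_) hA
  classical
  have hm : MeasurableSet (Set.pi (s : Set ℕ) t) :=
    MeasurableSet.pi (Set.to_countable _) fun i _ => ht i
  -- The indicator of the box is absorbed into the factors, so that the integrand stays a product
  -- over independent coordinates.
  let g : ℕ → X → ℝ≥0∞ := fun i => (if i ∈ s then t i else Set.univ).indicator (r i)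
  have hmi : ∀ i, MeasurableSet (if i ∈ s then t i else Set.univ) := fun i => by
    split_ifs
    exacts [ht i, .univ]
  have hg : ∀ i, Measurable (g i) := fun i => (hr i).indicator (hmi i)
  have hgp : (Set.pi (s : Set ℕ) t).indicator (fun ω => ∏ i ∈ Finset.range k, r i (ω i))
      = fun ω => ∏ i ∈ Finset.range k, g i (ω i) := by
    funext ω
    by_cases hω : ω ∈ Set.pi (s : Set ℕ) t
    · rw [Set.indicator_of_mem hω]
      refine Finset.prod_congr rfl fun i _ => ?_
      have : ω i ∈ (if i ∈ s then t i else Set.univ) := by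
        split_ifs with hi
        exacts [hω i hi, trivial]
      exact (Set.indicator_of_mem this _).symm
    · rw [Set.indicator_of_notMem hω]
      simp only [Set.mem_pi, not_forall] at hω
      obtain ⟨i, hi, hit⟩ := hω
      refine (Finset.prod_eq_zero (Finset.mem_range.2 (hs hi)) ?_).symm
      have hi' : i ∈ s := hi
      exact Set.indicator_of_notMem (by simpa [hi'] using hit) _
  have hind : iIndepFun (fun i (ω : ℕ → X) => g i (ω i)) (Measure.infinitePi μ) :=
    iIndepFun_infinitePi (P := μ) (X := g) hg
  rw [withDensity_apply _ hm, ← lintegral_indicator hm, hgp]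
  beta_reduce
  rw [lintegral_prod_eq_prod_lintegral_of_indepFun _ (fun i (ω : ℕ → X) => g i (ω i)) hind
      (fun i => (hg i).comp (measurable_pi_apply i)), Measure.infinitePi_pi _ fun i _ => ht i]
  have hint : ∀ i, ∫⁻ ω, g i (ω i) ∂(Measure.infinitePi μ) = ∫⁻ x, g i x ∂(μ i) := fun i => by
    rw [← Measure.infinitePi_map_eval μ i, lintegral_map (hg i) (measurable_pi_apply i)]
  have hval : ∀ i ∈ Finset.range k, ∫⁻ ω, g i (ω i) ∂(Measure.infinitePi μ)
      = if i ∈ s then ν i (t i) else 1 := fun i hi => by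
    rw [hint, lintegral_indicator (hmi i), ← withDensity_apply _ (hmi i),
      ← h i (Finset.mem_range.1 hi)]
    split_ifs <;> simp
  rw [Finset.prod_congr rfl hval, Finset.prod_ite_mem,
    Finset.inter_eq_right.2 fun i hi => Finset.mem_range.2 (hs hi)]

end SequenceSpace

/-! ### Pairs of densities and their log-likelihood ratio -/

section Densities

variable {X : Type*} [MeasurableSpace X] {ν : Measure X} {q₀ q₁ : X → ℝ}

/-- Two mutually absolutely continuous densities with finite divergences. -/
structure RegularPair (ν : Measure X) (q₀ q₁ : X → ℝ) : Prop where
  pdf₀ : IsPDF ν q₀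
  pdf₁ : IsPDF ν q₁
  pos₀ : ∀ᵐ x ∂(obsDist ν q₀), 0 < q₀ x ∧ 0 < q₁ x
  pos₁ : ∀ᵐ x ∂(obsDist ν q₁), 0 < q₀ x ∧ 0 < q₁ x
  kl_ne_top : kl ν q₀ q₁ ≠ ∞
  kl_symm_ne_top : kl ν q₁ q₀ ≠ ∞

lemma RegularPair.symm (h : RegularPair ν q₀ q₁) : RegularPair ν q₁ q₀ :=
  ⟨h.pdf₁, h.pdf₀, h.pos₁.mono fun _ => And.symm, h.pos₀.mono fun _ => And.symm,
    h.kl_symm_ne_top, h.kl_ne_top⟩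

lemma IsPDF.isProbabilityMeasure {p : X → ℝ} (hp : IsPDF ν p) :
    IsProbabilityMeasure (obsDist ν p) :=
  ⟨by rw [obsDist, withDensity_apply _ .univ, setLIntegral_univ, hp.lintegral_eq_one]⟩

/-- The log-likelihood ratio of one observation. -/
noncomputable def llRatio (q₀ q₁ : X → ℝ) (x : X) : ℝ := Real.log (q₁ x / q₀ x)

omit [MeasurableSpace X] in
lemma llRatio_swap : llRatio q₁ q₀ = fun x => -llRatio q₀ q₁ x := by
  funext x
  rw [llRatio, llRatio, ← Real.log_inv, inv_div]

omit [MeasurableSpace X] in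
lemma llrWalk_eq (k : ℕ) (ω : ℕ → X) :
    llrWalk q₀ q₁ k ω = ∑ j ∈ Finset.range k, llRatio q₀ q₁ (ω j) := rfl

lemma RegularPair.measurable_llRatio (h : RegularPair ν q₀ q₁) : Measurable (llRatio q₀ q₁) :=
  Real.measurable_log.comp (h.pdf₁.measurable.div h.pdf₀.measurable)

/-- Since `Real.log 0 = 0`, the exponential equals q₁/q₀ only where both densities are positive,
which is almost sure under q₀ by `pos₀`. `pos₁` excludes q₀ = 0 < q₁, where q₀ · (q₁/q₀) would not
return q₁. -/
lemma RegularPair.obsDist_eq_withDensity (h : RegularPair ν q₀ q₁) :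
    obsDist ν q₁
      = (obsDist ν q₀).withDensity fun x => ENNReal.ofReal (Real.exp (llRatio q₀ q₁ x)) := by
  have hm₀ : Measurable fun x => ENNReal.ofReal (q₀ x) := h.pdf₀.measurable.ennreal_ofReal
  have hm₁ : Measurable fun x => ENNReal.ofReal (q₁ x) := h.pdf₁.measurable.ennreal_ofReal
  have hm : Measurable fun x => ENNReal.ofReal (q₁ x / q₀ x) :=
    (h.pdf₁.measurable.div h.pdf₀.measurable).ennreal_ofReal
  have e : (obsDist ν q₀).withDensity (fun x => ENNReal.ofReal (Real.exp (llRatio q₀ q₁ x)))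
      = (obsDist ν q₀).withDensity fun x => ENNReal.ofReal (q₁ x / q₀ x) := by
    refine withDensity_congr_ae (h.pos₀.mono fun x hx => ?_)
    dsimp only
    rw [llRatio, Real.exp_log (div_pos hx.2 hx.1)]
  rw [e, obsDist, obsDist, ← withDensity_mul _ hm₀ hm]
  refine withDensity_congr_ae ?_
  have h1 := h.pos₁
  rw [obsDist, ae_withDensity_iff hm₁] at h1
  filter_upwards [h1] with x hx
  rw [Pi.mul_apply]
  rcases (h.pdf₁.nonneg x).eq_or_lt with h0 | h0
  · simp [← h0]
  · have := (hx (by simpa using h0)).1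
    rw [← ENNReal.ofReal_mul this.le, mul_div_cancel₀ _ this.ne']

lemma RegularPair.integral_llRatio_right (h : RegularPair ν q₀ q₁) :
    Integrable (llRatio q₀ q₁) (obsDist ν q₁) ∧
      ∫ x, llRatio q₀ q₁ x ∂(obsDist ν q₁) = (kl ν q₁ q₀).toReal := by
  have := h.pdf₀.isProbabilityMeasure
  have := h.pdf₁.isProbabilityMeasure
  obtain ⟨hac, hint⟩ := InformationTheory.klDiv_ne_top_iff.1 h.kl_symm_ne_top
  have hae : llr (obsDist ν q₁) (obsDist ν q₀) =ᵐ[obsDist ν q₁] llRatio q₀ q₁ := by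
    have hd := Measure.rnDeriv_withDensity (obsDist ν q₀)
      (f := fun x => ENNReal.ofReal (Real.exp (llRatio q₀ q₁ x)))
      h.measurable_llRatio.exp.ennreal_ofReal
    rw [← h.obsDist_eq_withDensity] at hd
    filter_upwards [hac.ae_le hd] with x hx
    rw [llr, hx, ENNReal.toReal_ofReal (Real.exp_pos _).le, Real.log_exp]
  refine ⟨(integrable_congr hae).1 hint, ?_⟩
  rw [kl, InformationTheory.toReal_klDiv_of_measure_eq hac (by simp), integral_congr_ae hae]

lemma RegularPair.integral_llRatio_left (h : RegularPair ν q₀ q₁) :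
    Integrable (llRatio q₀ q₁) (obsDist ν q₀) ∧
      ∫ x, llRatio q₀ q₁ x ∂(obsDist ν q₀) = -(kl ν q₀ q₁).toReal := by
  obtain ⟨h1, h2⟩ := h.symm.integral_llRatio_right
  rw [llRatio_swap] at h1 h2
  refine ⟨by simpa using h1.neg, ?_⟩
  rw [← h2, integral_neg, neg_neg]

lemma changeLaw_one : changeLaw ν q₀ q₁ 1 = iidLaw ν q₁ := by
  simp [changeLaw, iidLaw]

lemma isProbabilityMeasure_ite (h₀ : IsPDF ν q₀) (h₁ : IsPDF ν q₁) (t i : ℕ) :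
    IsProbabilityMeasure (if i + 1 < t then obsDist ν q₀ else obsDist ν q₁) := by
  split_ifs
  exacts [h₀.isProbabilityMeasure, h₁.isProbabilityMeasure]

lemma isProbabilityMeasure_iidLaw {p : X → ℝ} (hp : IsPDF ν p) :
    IsProbabilityMeasure (iidLaw ν p) := by
  have := hp.isProbabilityMeasure
  rw [iidLaw]
  infer_instance

lemma isProbabilityMeasure_changeLaw (h₀ : IsPDF ν q₀) (h₁ : IsPDF ν q₁) (t : ℕ) :
    IsProbabilityMeasure (changeLaw ν q₀ q₁ t) := by
  have := isProbabilityMeasure_ite h₀ h₁ t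
  rw [changeLaw]
  infer_instance

lemma map_shift_iidLaw {p : X → ℝ} (hp : IsPDF ν p) (s : ℕ) :
    (iidLaw ν p).map (shift s) = iidLaw ν p := by
  have := hp.isProbabilityMeasure
  exact map_shift_infinitePi _ s

lemma map_shift_changeLaw (h₀ : IsPDF ν q₀) (h₁ : IsPDF ν q₁) {s t : ℕ} (hst : t ≤ s + 1) :
    (changeLaw ν q₀ q₁ t).map (shift s) = iidLaw ν q₁ := by
  have := isProbabilityMeasure_ite h₀ h₁ t
  rw [changeLaw, map_shift_infinitePi, iidLaw]
  congr 1
  funext j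
  rw [if_neg (by omega)]

/-- Before the change the law of the observations is the law without change. -/
lemma changeLaw_apply_of_past (h₀ : IsPDF ν q₀) (h₁ : IsPDF ν q₁) {s : ℕ} {A : Set (ℕ → X)}
    (hA : MeasurableSet[obsFiltration X s] A) :
    changeLaw ν q₀ q₁ (s + 1) A = iidLaw ν q₀ A := by
  have := isProbabilityMeasure_ite h₀ h₁ (s + 1)
  have := h₀.isProbabilityMeasure
  refine infinitePi_congr_coordSigma (S := Set.Iio s) (fun i hi => if_pos ?_) hA
  have : i < s := hi
  omega

/-- The first `s` coordinates contribute density 1, so the likelihood ratio involves only the `m`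
observations after the change. -/
lemma RegularPair.changeLaw_apply (h : RegularPair ν q₀ q₁) {s m : ℕ} {A : Set (ℕ → X)}
    (hA : MeasurableSet[obsFiltration X (s + m)] A) :
    changeLaw ν q₀ q₁ (s + 1) A
      = ∫⁻ ω in A, ENNReal.ofReal (Real.exp (llrWalk q₀ q₁ m (shift s ω))) ∂(iidLaw ν q₀) := by
  have := isProbabilityMeasure_ite h.pdf₀ h.pdf₁ (s + 1)
  have := h.pdf₀.isProbabilityMeasure
  have hm := h.measurable_llRatio.exp.ennreal_ofReal
  rw [changeLaw, infinitePi_eq_setLIntegral_prod (μ := fun _ => obsDist ν q₀)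
    (r := fun i x => if i + 1 < s + 1 then 1 else ENNReal.ofReal (Real.exp (llRatio q₀ q₁ x)))
    (fun i => by split_ifs; exacts [measurable_const, hm]) (fun i _ => ?_) hA, iidLaw]
  · refine lintegral_congr fun ω => ?_
    rw [Finset.prod_range_add, Finset.prod_congr rfl
      (fun i hi => if_pos (Nat.add_lt_add_right (Finset.mem_range.1 hi) 1)),
      Finset.prod_const_one, one_mul, llrWalk_eq, Real.exp_sum,
      ENNReal.ofReal_prod_of_nonneg fun _ _ => (Real.exp_pos _).le]
    refine Finset.prod_congr rfl fun i _ => ?_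
    rw [if_neg (by omega), shift, add_comm]
  · split_ifs
    · exact withDensity_one.symm
    · exact h.obsDist_eq_withDensity

/-- Change of measure on events on which the log-likelihood ratio is at least `a`. -/
lemma RegularPair.exp_mul_iidLaw_le (h : RegularPair ν q₀ q₁) {s m : ℕ} {A : Set (ℕ → X)}
    (hA : MeasurableSet[obsFiltration X (s + m)] A) {a : ℝ}
    (ha : ∀ ω ∈ A, a ≤ llrWalk q₀ q₁ m (shift s ω)) :
    ENNReal.ofReal (Real.exp a) * iidLaw ν q₀ A ≤ changeLaw ν q₀ q₁ (s + 1) A := by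
  rw [h.changeLaw_apply hA, ← setLIntegral_const]
  exact setLIntegral_mono' (measurableSet_obs hA) fun ω hω =>
    ENNReal.ofReal_le_ofReal (Real.exp_le_exp.2 (ha ω hω))

lemma measurable_sum_coord {f : X → ℝ} (hf : Measurable f) {k n : ℕ} (hk : k ≤ n) :
    Measurable[obsFiltration X n] fun ω : ℕ → X => ∑ j ∈ Finset.range k, f (ω j) := by
  refine Finset.measurable_fun_sum _ fun j hj => hf.comp (measurable_coord ?_)
  have := Finset.mem_range.1 hj
  exact show j < n by omega

lemma RegularPair.measurable_llrWalk (h : RegularPair ν q₀ q₁) {k n : ℕ} (hk : k ≤ n) :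
    Measurable[obsFiltration X n] (llrWalk q₀ q₁ k) :=
  measurable_sum_coord h.measurable_llRatio hk

lemma RegularPair.measurable_llrWalk' (h : RegularPair ν q₀ q₁) (k : ℕ) :
    Measurable (llrWalk q₀ q₁ k) :=
  (h.measurable_llrWalk le_rfl).mono ((obsFiltration X).le k) le_rfl

lemma measurePreserving_coord {p : X → ℝ} (hp : IsPDF ν p) (j : ℕ) :
    MeasurePreserving (fun ω : ℕ → X => ω j) (iidLaw ν p) (obsDist ν p) := by
  have := hp.isProbabilityMeasure
  exact measurePreserving_eval_infinitePi (fun _ => obsDist ν p) j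

lemma RegularPair.integral_llrWalk (h : RegularPair ν q₀ q₁) (m : ℕ) :
    Integrable (llrWalk q₀ q₁ m) (iidLaw ν q₀) ∧
      ∫ ω, llrWalk q₀ q₁ m ω ∂(iidLaw ν q₀) = -(m * (kl ν q₀ q₁).toReal) := by
  obtain ⟨h1, h2⟩ := h.integral_llRatio_left
  have hi : ∀ j ∈ Finset.range m,
      Integrable (fun ω : ℕ → X => llRatio q₀ q₁ (ω j)) (iidLaw ν q₀) := fun j _ =>
    (measurePreserving_coord h.pdf₀ j).integrable_comp_of_integrable h1
  refine ⟨integrable_finsetSum _ hi, ?_⟩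
  simp only [llrWalk_eq]
  rw [integral_finsetSum _ hi]
  have : ∀ j ∈ Finset.range m, ∫ ω, llRatio q₀ q₁ (ω j) ∂(iidLaw ν q₀)
      = -(kl ν q₀ q₁).toReal := fun j _ => by
    rw [← h2, ← (measurePreserving_coord h.pdf₀ j).map_eq,
      integral_map (measurable_pi_apply j).aemeasurable
        h.measurable_llRatio.aestronglyMeasurable]
  rw [Finset.sum_congr rfl this]
  simp

/-- Without change, the log-likelihood ratio of `m` observations is at most `-2` with probability
at most `m D(q₀‖q₁)`. -/
lemma RegularPair.iidLaw_llrWalk_le (h : RegularPair ν q₀ q₁) (m : ℕ) :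
    iidLaw ν q₀ {ω | llrWalk q₀ q₁ m ω ≤ -2} ≤ ENNReal.ofReal (m * (kl ν q₀ q₁).toReal) := by
  have := isProbabilityMeasure_iidLaw h.pdf₀
  have := isProbabilityMeasure_changeLaw h.pdf₀ h.pdf₁ 1
  set W := llrWalk q₀ q₁ m
  have hW : Measurable W := h.measurable_llrWalk' m
  obtain ⟨hWi, hWe⟩ := h.integral_llrWalk m
  have he : ∫⁻ ω, ENNReal.ofReal (Real.exp (W ω)) ∂(iidLaw ν q₀) = 1 := by
    have := h.changeLaw_apply (s := 0) (m := m) (A := Set.univ) .univ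
    rw [setLIntegral_univ, zero_add, measure_univ] at this
    exact this.symm
  have hei : Integrable (fun ω => Real.exp (W ω)) (iidLaw ν q₀) := by
    rw [← lintegral_ofReal_ne_top_iff_integrable hW.exp.aestronglyMeasurable
      (ae_of_all _ fun _ => (Real.exp_pos _).le), he]
    exact ENNReal.one_ne_top
  have heI : ∫ ω, Real.exp (W ω) ∂(iidLaw ν q₀) = 1 := by
    rw [integral_eq_lintegral_of_nonneg_ae (ae_of_all _ fun _ => (Real.exp_pos _).le)
      hW.exp.aestronglyMeasurable, he, ENNReal.toReal_one]
  -- As E[e^W] = 1, the nonnegative variable e^W - 1 - W has mean m D(q₀‖q₁). It is at least 1 where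
  -- W ≤ -2, so Markov's inequality gives the claim.
  have hi : Integrable (fun ω => Real.exp (W ω) - 1 - W ω) (iidLaw ν q₀) :=
    (hei.sub (integrable_const 1)).sub hWi
  have hI : ∫ ω, (Real.exp (W ω) - 1 - W ω) ∂(iidLaw ν q₀) = m * (kl ν q₀ q₁).toReal := by
    have e1 : ∫ ω, (Real.exp (W ω) - 1) ∂(iidLaw ν q₀) = 0 := by
      rw [integral_sub hei (integrable_const 1), heI]
      simp
    rw [integral_sub (f := fun ω => Real.exp (W ω) - 1) (hei.sub (integrable_const 1)) hWi, e1, hWe]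
    ring
  have hn : ∀ ω, 0 ≤ Real.exp (W ω) - 1 - W ω := fun ω => by
    linarith [Real.add_one_le_exp (W ω)]
  rw [← hI, ofReal_integral_eq_lintegral_ofReal hi (ae_of_all _ hn)]
  rw [← one_mul (iidLaw ν q₀ _)]
  refine le_trans ?_ (mul_meas_ge_le_lintegral₀
    ((hW.exp.sub_const 1).sub hW).ennreal_ofReal.aemeasurable 1)
  gcongr with ω
  intro hω
  have : W ω ≤ -2 := hω
  show (1 : ℝ≥0∞) ≤ ENNReal.ofReal (Real.exp (W ω) - 1 - W ω)
  rw [← ENNReal.ofReal_one]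
  exact ENNReal.ofReal_le_ofReal (by linarith [Real.exp_pos (W ω)])

end Densities

/-! ### Worst-case delay and the lower bound -/

/-- Counting multiples of `m` below `x`. -/
lemma toENNReal_le_tsum {m : ℕ} (hm : 0 < m) (x : ℕ∞) :
    (x : ℝ≥0∞) ≤ ∑' i : ℕ, (m : ℝ≥0∞) * (if ((i * m : ℕ) : ℕ∞) < x then 1 else 0) := by
  induction x using ENat.recTopCoe with
  | top =>
    have : (m : ℝ≥0∞) ≠ 0 := by exact_mod_cast hm.ne'
    have h : ∀ i : ℕ, ((i * m : ℕ) : ℕ∞) < ⊤ := fun i => ENat.natCast_lt_top _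
    simp only [h, if_true, mul_one]
    rw [ENNReal.tsum_const_eq_top_of_ne_zero this]
    exact le_top
  | coe n =>
    -- `(n + m - 1) / m` is n/m rounded up, the number of multiples of `m` below `n`.
    refine le_trans ?_ (ENNReal.sum_le_tsum (Finset.range ((n + m - 1) / m)))
    have h : ∀ i ∈ Finset.range ((n + m - 1) / m),
        (m : ℝ≥0∞) * (if ((i * m : ℕ) : ℕ∞) < (n : ℕ∞) then 1 else 0) = m := by
      intro i hi
      have h1 := Finset.mem_range.1 hi
      have h2 : (i + 1) * m ≤ n + m - 1 := (Nat.le_div_iff_mul_le hm).1 h1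
      rw [add_mul, one_mul] at h2
      rw [if_pos (by exact_mod_cast (by omega : i * m < n)), mul_one]
    rw [Finset.sum_congr rfl h, Finset.sum_const, Finset.card_range, nsmul_eq_mul]
    have h3 : n ≤ (n + m - 1) / m * m := by
      have := Nat.div_add_mod (n + m - 1) m
      have := Nat.mod_lt (n + m - 1) hm
      rw [mul_comm]
      omega
    simp only [ENat.toENNReal_coe]
    exact_mod_cast h3

section Delay

variable {X : Type*} [MeasurableSpace X] {ν : Measure X} {q₀ q₁ : X → ℝ}

lemma enat_add_one_sub_cast (x : ℕ∞) (s : ℕ) : x + 1 - ((s + 1 : ℕ) : ℕ∞) = x - s := by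
  induction x using ENat.recTopCoe with
  | top => simp
  | coe n =>
    norm_cast
    omega

/-- Integrating the conditional delay over an event of the past removes the essential supremum; the
past has the same law with or without the change. -/
lemma setLIntegral_le_worstDelay_mul (h₀ : IsPDF ν q₀) (h₁ : IsPDF ν q₁) (T : (ℕ → X) → ℕ∞)
    (s : ℕ) {B : Set (ℕ → X)} (hB : MeasurableSet[obsFiltration X s] B) :
    ∫⁻ ω in B, ((T ω - s : ℕ∞) : ℝ≥0∞) ∂(changeLaw ν q₀ q₁ (s + 1))
      ≤ worstDelay ν q₀ q₁ T * iidLaw ν q₀ B := by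
  have := isProbabilityMeasure_changeLaw h₀ h₁ (s + 1)
  set f : (ℕ → X) → ℝ≥0∞ := fun ω => ((T ω + 1 - ((s + 1 : ℕ) : ℕ∞) : ℕ∞) : ℝ≥0∞)
  have hf : (fun ω => ((T ω - s : ℕ∞) : ℝ≥0∞)) = f := by
    funext ω
    simp only [f]
    rw [enat_add_one_sub_cast]
  have hle : essSup (condLExp (obsFiltration X s) (changeLaw ν q₀ q₁ (s + 1)) f)
      (changeLaw ν q₀ q₁ (s + 1)) ≤ worstDelay ν q₀ q₁ T :=
    le_iSup₂_of_le (s + 1) (by omega) le_rfl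
  rw [hf, ← setLIntegral_condLExp ((obsFiltration X).le s) _ f hB,
    ← changeLaw_apply_of_past h₀ h₁ hB, ← setLIntegral_const]
  exact lintegral_mono_ae ((ae_restrict_of_ae (ENNReal.ae_le_essSup _)).mono
    fun ω hω => hω.trans hle)

/-- A conditional expectation is almost surely at most `C` as soon as its integrals over the events
of the past are. -/
lemma worstDelay_le (h₀ : IsPDF ν q₀) (h₁ : IsPDF ν q₁) (T : (ℕ → X) → ℕ∞) (C : ℝ≥0∞)
    (h : ∀ (s : ℕ) (B : Set (ℕ → X)), MeasurableSet[obsFiltration X s] B →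
      ∫⁻ ω in B, ((T ω - s : ℕ∞) : ℝ≥0∞) ∂(changeLaw ν q₀ q₁ (s + 1))
        ≤ C * changeLaw ν q₀ q₁ (s + 1) B) :
    worstDelay ν q₀ q₁ T ≤ C := by
  refine iSup₂_le fun t ht => ?_
  obtain ⟨s, rfl⟩ : ∃ s, t = s + 1 := ⟨t - 1, by omega⟩
  have := isProbabilityMeasure_changeLaw h₀ h₁ (s + 1)
  have hF := (obsFiltration X).le s
  refine essSup_le_of_ae_le _ ?_
  refine ae_le_of_ae_le_trim (hm := hF) ?_
  refine ae_le_of_forall_setLIntegral_le_of_sigmaFinite₀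
    (measurable_condLExp _ _ _).aemeasurable fun B hB _ => ?_
  rw [Nat.add_sub_cancel, setLIntegral_condLExp_trim hF _ _ hB, setLIntegral_const,
    trim_measurableSet_eq hF hB]
  refine le_trans (le_of_eq ?_) (h s B hB)
  exact lintegral_congr fun ω => by rw [enat_add_one_sub_cast]

lemma measurableSet_lt_stopping {T : (ℕ → X) → ℕ∞} (hT : IsStoppingTime (obsFiltration X) T)
    (s : ℕ) : MeasurableSet[obsFiltration X s] {ω | (s : ℕ∞) < T ω} := by
  have : {ω | (s : ℕ∞) < T ω} = {ω | T ω ≤ (s : ℕ∞)}ᶜ := by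
    ext ω; simp
  rw [this]
  exact (hT s).compl

/-- If the delay is small compared to `m` and `m D(q₀‖q₁)` is small, then a run that has not
stopped stops within `m` more observations with probability at least `1 / 2`, without change. -/
lemma RegularPair.iidLaw_survival_le (h : RegularPair ν q₀ q₁) {T : (ℕ → X) → ℕ∞}
    (hT : IsStoppingTime (obsFiltration X) T) {m : ℕ} (hm : 0 < m)
    (hmD : m * (kl ν q₀ q₁).toReal ≤ 1 / 4) (hW : 32 * worstDelay ν q₀ q₁ T ≤ m) (s : ℕ) :
    2 * iidLaw ν q₀ {ω | ((s + m : ℕ) : ℕ∞) < T ω} ≤ iidLaw ν q₀ {ω | (s : ℕ∞) < T ω} := by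
  have := isProbabilityMeasure_iidLaw h.pdf₀
  have := h.pdf₀.isProbabilityMeasure
  set B := {ω | (s : ℕ∞) < T ω}
  set E := {ω | ((s + m : ℕ) : ℕ∞) < T ω}
  set U := {ω : ℕ → X | llrWalk q₀ q₁ m ω ≤ -2}
  have hB : MeasurableSet[obsFiltration X s] B := measurableSet_lt_stopping hT s
  have hE : MeasurableSet[obsFiltration X (s + m)] E := measurableSet_lt_stopping hT (s + m)
  have hU : MeasurableSet[obsFiltration X m] U :=
    h.measurable_llrWalk le_rfl measurableSet_Iic
  have hU' := measurableSet_shift_preimage (s := s) hU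
  have hUF : MeasurableSet[obsFiltration X (s + m)] (shift s ⁻¹' U) :=
    coordSigma_mono (fun i hi => hi.2) _ hU'
  have hEB : E ⊆ B := fun ω (hω : ((s + m : ℕ) : ℕ∞) < T ω) =>
    lt_of_le_of_lt (Nat.cast_le.2 (Nat.le_add_right s m)) hω
  -- Markov's inequality under a change right after time `s`: on `E` the delay is at least `m`.
  have hEP : 32 * changeLaw ν q₀ q₁ (s + 1) E ≤ iidLaw ν q₀ B := by
    have h1 : (m : ℝ≥0∞) * changeLaw ν q₀ q₁ (s + 1) E
        ≤ worstDelay ν q₀ q₁ T * iidLaw ν q₀ B := by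
      refine le_trans ?_ (setLIntegral_le_worstDelay_mul h.pdf₀ h.pdf₁ T s hB)
      refine le_trans ?_ (lintegral_mono_set hEB)
      rw [← setLIntegral_const]
      refine setLIntegral_mono' (measurableSet_obs hE) fun ω hω => ?_
      have h2 : (m : ℕ∞) ≤ T ω - s :=
        ENat.le_sub_of_add_le_left (by simp) (by exact_mod_cast (le_of_lt hω))
      exact_mod_cast ENat.toENNReal_le.2 h2
    have hm0 : (m : ℝ≥0∞) ≠ 0 := by exact_mod_cast hm.ne'
    rw [← ENNReal.mul_le_mul_iff_right hm0 (ENNReal.natCast_ne_top m)]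
    calc (m : ℝ≥0∞) * (32 * changeLaw ν q₀ q₁ (s + 1) E)
        = 32 * (m * changeLaw ν q₀ q₁ (s + 1) E) := by ring
      _ ≤ 32 * (worstDelay ν q₀ q₁ T * iidLaw ν q₀ B) := by gcongr
      _ = (32 * worstDelay ν q₀ q₁ T) * iidLaw ν q₀ B := by ring
      _ ≤ m * iidLaw ν q₀ B := by gcongr
  -- Where the log-likelihood ratio exceeds -2, returning to the law without change costs a factor
  -- e² ≤ 8, and 8/32 = 1/4.
  have h1 : 4 * iidLaw ν q₀ (E \ shift s ⁻¹' U) ≤ iidLaw ν q₀ B := by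
    have hc := h.exp_mul_iidLaw_le (A := E \ shift s ⁻¹' U) (hE.diff hUF) (a := -2)
      (fun ω hω => (not_le.1 hω.2).le)
    have he : (1 : ℝ≥0∞) ≤ 8 * ENNReal.ofReal (Real.exp (-2)) := by
      rw [show (8 : ℝ≥0∞) = ENNReal.ofReal 8 by simp, ← ENNReal.ofReal_mul (by norm_num),
        ← ENNReal.ofReal_one]
      refine ENNReal.ofReal_le_ofReal ?_
      have h2 : Real.exp 2 ≤ 8 := by
        have := Real.exp_one_lt_d9
        have h3 : Real.exp 2 = Real.exp 1 * Real.exp 1 := by rw [← Real.exp_add]; norm_num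
        rw [h3]
        nlinarith [Real.exp_pos 1]
      rw [Real.exp_neg]
      rw [← div_eq_mul_inv, le_div_iff₀ (Real.exp_pos 2)]
      linarith
    calc 4 * iidLaw ν q₀ (E \ shift s ⁻¹' U)
        ≤ 4 * (8 * ENNReal.ofReal (Real.exp (-2)) * iidLaw ν q₀ (E \ shift s ⁻¹' U)) := by
          gcongr
          exact le_mul_of_one_le_left' he
      _ = 32 * (ENNReal.ofReal (Real.exp (-2)) * iidLaw ν q₀ (E \ shift s ⁻¹' U)) := by ring
      _ ≤ 32 * changeLaw ν q₀ q₁ (s + 1) E := by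
          gcongr
          exact hc.trans (measure_mono Set.sdiff_subset)
      _ ≤ _ := hEP
  -- The exceptional event concerns observations after time `s`, so it is independent of `B`; its
  -- probability is at most 1/4.
  have h2 : 4 * iidLaw ν q₀ (E ∩ shift s ⁻¹' U) ≤ iidLaw ν q₀ B := by
    have hi : iidLaw ν q₀ (B ∩ shift s ⁻¹' U) = iidLaw ν q₀ B * iidLaw ν q₀ U := by
      rw [iidLaw, infinitePi_inter (fun _ => obsDist ν q₀) (S := Set.Iio s) ?_ hB hU']
      · congr 1
        change iidLaw ν q₀ _ = iidLaw ν q₀ _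
        conv_rhs => rw [← map_shift_iidLaw h.pdf₀ s,
          Measure.map_apply (measurable_shift s) (measurableSet_obs hU)]
      · exact Set.disjoint_left.2 fun i (hi : i < s) hi' => absurd hi'.1 (not_le.2 hi)
    have hu : 4 * iidLaw ν q₀ U ≤ 1 := by
      calc 4 * iidLaw ν q₀ U ≤ 4 * ENNReal.ofReal (1 / 4) := by
            gcongr
            exact (h.iidLaw_llrWalk_le m).trans (ENNReal.ofReal_le_ofReal hmD)
        _ = 1 := by
            rw [show (4 : ℝ≥0∞) = ENNReal.ofReal 4 by simp, ← ENNReal.ofReal_mul (by norm_num)]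
            norm_num
    calc 4 * iidLaw ν q₀ (E ∩ shift s ⁻¹' U)
        ≤ 4 * iidLaw ν q₀ (B ∩ shift s ⁻¹' U) := by gcongr
      _ = iidLaw ν q₀ B * (4 * iidLaw ν q₀ U) := by rw [hi]; ring
      _ ≤ iidLaw ν q₀ B * 1 := by gcongr
      _ = _ := mul_one _
  have h3 : iidLaw ν q₀ E = iidLaw ν q₀ (E ∩ shift s ⁻¹' U) + iidLaw ν q₀ (E \ shift s ⁻¹' U) :=
    (measure_inter_add_sdiff E (measurableSet_obs hUF)).symm
  rw [← ENNReal.mul_le_mul_iff_right (a := 2) (by simp) (by simp), h3]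
  calc 2 * (2 * (iidLaw ν q₀ (E ∩ shift s ⁻¹' U) + iidLaw ν q₀ (E \ shift s ⁻¹' U)))
      = 4 * iidLaw ν q₀ (E ∩ shift s ⁻¹' U) + 4 * iidLaw ν q₀ (E \ shift s ⁻¹' U) := by ring
    _ ≤ iidLaw ν q₀ B + iidLaw ν q₀ B := add_le_add h2 h1
    _ = 2 * iidLaw ν q₀ B := by ring

lemma measurable_stopping {T : (ℕ → X) → ℕ∞} (hT : IsStoppingTime (obsFiltration X) T)
    (s : ℕ) : MeasurableSet {ω | (s : ℕ∞) < T ω} :=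
  measurableSet_obs (measurableSet_lt_stopping hT s)

/-- The expectation of a stopping time is controlled by its survival probabilities. -/
lemma lintegral_stopping_le_tsum {T : (ℕ → X) → ℕ∞} (hT : IsStoppingTime (obsFiltration X) T)
    {m : ℕ} (hm : 0 < m) (P : Measure (ℕ → X)) :
    ∫⁻ ω, (T ω : ℝ≥0∞) ∂P ≤ ∑' i : ℕ, m * P {ω | ((i * m : ℕ) : ℕ∞) < T ω} := by
  have hmeas : ∀ i : ℕ, MeasurableSet {ω | ((i * m : ℕ) : ℕ∞) < T ω} := fun i =>
    measurable_stopping hT (i * m)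
  have hind : ∀ i : ℕ, (fun ω => (m : ℝ≥0∞) * (if ((i * m : ℕ) : ℕ∞) < T ω then 1 else 0))
      = {ω | ((i * m : ℕ) : ℕ∞) < T ω}.indicator fun _ => (m : ℝ≥0∞) := fun i => by
    funext ω
    by_cases hω : ((i * m : ℕ) : ℕ∞) < T ω <;> simp [Set.indicator]
  calc ∫⁻ ω, (T ω : ℝ≥0∞) ∂P
      ≤ ∫⁻ ω, ∑' i : ℕ, (m : ℝ≥0∞) * (if ((i * m : ℕ) : ℕ∞) < T ω then 1 else 0) ∂P :=
        lintegral_mono fun ω => toENNReal_le_tsum hm (T ω)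
    _ = ∑' i : ℕ, m * P {ω | ((i * m : ℕ) : ℕ∞) < T ω} := by
        rw [lintegral_tsum fun i => by
          rw [hind]
          exact (measurable_const.indicator (hmeas i)).aemeasurable]
        refine tsum_congr fun i => ?_
        rw [hind, lintegral_indicator (hmeas i), setLIntegral_const]

/-- Lower bound for the optimal delay. -/
lemma RegularPair.le_optDelay (h : RegularPair ν q₀ q₁) {γ : ℝ} {m : ℕ} (hm : 0 < m)
    (hmD : m * (kl ν q₀ q₁).toReal ≤ 1 / 4) (hγ : 2 * (m : ℝ) < γ) :
    (m : ℝ≥0∞) ≤ 32 * optDelay ν q₀ q₁ γ := by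
  have := isProbabilityMeasure_iidLaw h.pdf₀
  by_contra hcon
  rw [not_le, mul_comm, ← ENNReal.lt_div_iff_mul_lt (by simp) (by simp), optDelay] at hcon
  simp only [iInf_lt_iff] at hcon
  obtain ⟨T, ⟨hT, hTγ⟩, hW⟩ := hcon
  rw [ENNReal.lt_div_iff_mul_lt (by simp) (by simp), mul_comm] at hW
  have hs := h.iidLaw_survival_le hT hm hmD hW.le
  -- Geometric survival forces E[T] ≤ 2m < γ, contradicting the constraint on `T`.
  have hgeo : ∀ i : ℕ, iidLaw ν q₀ {ω | ((i * m : ℕ) : ℕ∞) < T ω} ≤ (2⁻¹ : ℝ≥0∞) ^ i := by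
    intro i
    induction i with
    | zero => simpa using prob_le_one
    | succ i ih =>
      have h1 := (hs (i * m)).trans ih
      rw [add_mul, one_mul, pow_succ, ← div_eq_mul_inv, ENNReal.le_div_iff_mul_le (by simp)
        (by simp), mul_comm]
      exact h1
  have : ENNReal.ofReal γ ≤ ENNReal.ofReal (2 * m) := by
    refine hTγ.trans ((lintegral_stopping_le_tsum hT hm _).trans ?_)
    calc ∑' i : ℕ, (m : ℝ≥0∞) * iidLaw ν q₀ {ω | ((i * m : ℕ) : ℕ∞) < T ω}
        ≤ ∑' i : ℕ, (m : ℝ≥0∞) * (2⁻¹ : ℝ≥0∞) ^ i :=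
          ENNReal.tsum_le_tsum fun i => by gcongr; exact hgeo i
      _ = m * 2 := by rw [ENNReal.tsum_mul_left, ENNReal.tsum_geometric, ENNReal.one_sub_inv_two,
          inv_inv]
      _ = ENNReal.ofReal (2 * m) := by
          rw [ENNReal.ofReal_mul (by norm_num), ENNReal.ofReal_natCast, mul_comm]
          simp
  rw [ENNReal.ofReal_le_ofReal_iff (by positivity)] at this
  linarith

/-- Stopping at the deterministic time `⌈γ⌉`. -/
lemma optDelay_le_ceil (h₀ : IsPDF ν q₀) (h₁ : IsPDF ν q₁) (γ : ℝ) :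
    optDelay ν q₀ q₁ γ ≤ (⌈γ⌉₊ : ℝ≥0∞) := by
  have := isProbabilityMeasure_iidLaw h₀
  refine iInf₂_le_of_le (fun _ => (⌈γ⌉₊ : ℕ∞)) ⟨isStoppingTime_const _ _, ?_⟩ ?_
  · rw [lintegral_const, measure_univ, mul_one]
    simp only [ENat.toENNReal_coe]
    exact ENNReal.ofReal_le_natCast.2 (Nat.le_ceil γ)
  · refine worstDelay_le h₀ h₁ _ _ fun s B hB => ?_
    rw [setLIntegral_const]
    gcongr
    rw [← ENat.toENNReal_coe]
    exact ENat.toENNReal_le.2 tsub_le_self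

end Delay

/-! ### Stopping at the first rejecting block -/

section Blocks

variable {X : Type*} [MeasurableSpace X] {ν : Measure X} {q₀ q₁ : X → ℝ}

/-- All blocks of length `M` with number in `[i, i + n)` belong to `A`. -/
def blockEvent {X : Type*} (M : ℕ) (A : Set (ℕ → X)) (i n : ℕ) : Set (ℕ → X) :=
  {ω | ∀ j, i ≤ j → j < i + n → shift (j * M) ω ∈ A}

lemma blockEvent_succ {X : Type*} (M : ℕ) (A : Set (ℕ → X)) (i n : ℕ) :
    blockEvent M A i (n + 1) = blockEvent M A i n ∩ shift ((i + n) * M) ⁻¹' A := by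
  ext ω
  constructor
  · exact fun h => ⟨fun j h1 h2 => h j h1 (by omega), h (i + n) (by omega) (by omega)⟩
  · rintro ⟨h1, h2⟩ j hj hj'
    rcases Nat.lt_succ_iff_lt_or_eq.1 (show j < (i + n).succ by omega) with h | rfl
    · exact h1 j hj h
    · exact h2

lemma measurableSet_blockEvent {M : ℕ} {A : Set (ℕ → X)}
    (hA : MeasurableSet[obsFiltration X M] A) (i n : ℕ) :
    MeasurableSet[obsFiltration X ((i + n) * M)] (blockEvent M A i n) := by
  induction n with
  | zero =>
    have : blockEvent M A i 0 = Set.univ := by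
      ext ω
      simp only [blockEvent, Set.mem_ofPred_eq, Set.mem_univ, iff_true]
      omega
    rw [this]
    exact .univ
  | succ n ih =>
    have e : (i + (n + 1)) * M = (i + n) * M + M := by ring
    rw [blockEvent_succ, e]
    refine MeasurableSet.inter ((obsFiltration X).mono (Nat.le_add_right _ _) _ ih) ?_
    exact coordSigma_mono (fun j hj => hj.2) _ (measurableSet_shift_preimage hA)

/-- `B` and the blocks depend on disjoint sets of coordinates. Only blocks from `i` on need the
common probability `c`, which allows for a change before block `i`. -/
lemma measure_inter_blockEvent (μ : ℕ → Measure X) [∀ i, IsProbabilityMeasure (μ i)] {M s i : ℕ}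
    (hs : s ≤ i * M) {A B : Set (ℕ → X)} (hA : MeasurableSet[obsFiltration X M] A)
    (hB : MeasurableSet[obsFiltration X s] B) {c : ℝ≥0∞}
    (hc : ∀ j, i ≤ j → Measure.infinitePi μ (shift (j * M) ⁻¹' A) = c) (n : ℕ) :
    Measure.infinitePi μ (B ∩ blockEvent M A i n) = Measure.infinitePi μ B * c ^ n := by
  induction n with
  | zero =>
    rw [pow_zero, mul_one]
    congr 1
    ext ω
    simp only [blockEvent, Set.mem_inter_iff, Set.mem_ofPred_eq, and_iff_left_iff_imp]
    omega
  | succ n ih =>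
    have hB' : MeasurableSet[coordSigma X (Set.Iio ((i + n) * M))] B :=
      (obsFiltration X).mono (hs.trans (Nat.mul_le_mul_right M (Nat.le_add_right i n))) _ hB
    rw [blockEvent_succ, ← Set.inter_assoc,
      infinitePi_inter μ (S := Set.Iio ((i + n) * M)) ?_
        (MeasurableSet.inter hB' (measurableSet_blockEvent hA i n))
        (measurableSet_shift_preimage hA), ih, hc _ (Nat.le_add_right i n), pow_succ, mul_assoc]
    exact Set.disjoint_left.2 fun j (hj : j < (i + n) * M) hj' => absurd hj'.1 (not_le.2 hj)

lemma iidLaw_shift_preimage {p : X → ℝ} (hp : IsPDF ν p) (s : ℕ) {A : Set (ℕ → X)}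
    (hA : MeasurableSet A) : iidLaw ν p (shift s ⁻¹' A) = iidLaw ν p A := by
  rw [← Measure.map_apply (measurable_shift s) hA, map_shift_iidLaw hp]

lemma iidLaw_blockEvent {p : X → ℝ} (hp : IsPDF ν p) {M : ℕ} {A : Set (ℕ → X)}
    (hA : MeasurableSet[obsFiltration X M] A) (n : ℕ) :
    iidLaw ν p (blockEvent M A 0 n) = iidLaw ν p A ^ n := by
  have := hp.isProbabilityMeasure
  have := measure_inter_blockEvent (fun _ => obsDist ν p) (s := 0) (i := 0) (B := Set.univ)
    (Nat.zero_le _) hA .univ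
    (fun j _ => iidLaw_shift_preimage hp (j * M) (measurableSet_obs hA)) n
  rwa [Set.univ_inter, measure_univ, one_mul] at this

/-- The end of the first block of length `M` that belongs to `R`. -/
noncomputable def blockTime {X : Type*} (M : ℕ) (R : Set (ℕ → X)) (ω : ℕ → X) : ℕ∞ :=
  ⨅ i : ℕ, ⨅ _ : shift (i * M) ω ∈ R, (((i + 1) * M : ℕ) : ℕ∞)

lemma blockTime_le_iff {X : Type*} {M : ℕ} {R : Set (ℕ → X)} {ω : ℕ → X} {n : ℕ} :
    blockTime M R ω ≤ n ↔ ∃ j, (j + 1) * M ≤ n ∧ shift (j * M) ω ∈ R := by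
  -- A strict inequality turns the infimum into an existence statement without showing that it is
  -- attained.
  rw [← ENat.lt_add_one_iff (by simp), blockTime]
  simp only [iInf_lt_iff]
  constructor
  · rintro ⟨j, hj, h⟩
    refine ⟨j, ?_, hj⟩
    have : (j + 1) * M < n + 1 := by exact_mod_cast h
    omega
  · rintro ⟨j, h, hj⟩
    refine ⟨j, hj, ?_⟩
    exact_mod_cast Nat.lt_succ_of_le h

lemma lt_blockTime_iff {X : Type*} {M : ℕ} (hM : 0 < M) {R : Set (ℕ → X)} {ω : ℕ → X} {i : ℕ} :
    ((i * M : ℕ) : ℕ∞) < blockTime M R ω ↔ ω ∈ blockEvent M Rᶜ 0 i := by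
  rw [← not_le, blockTime_le_iff]
  simp only [not_exists, not_and, blockEvent, Set.mem_ofPred_eq, zero_add, Set.mem_compl_iff]
  refine forall_congr' fun j => ?_
  rw [Nat.mul_le_mul_right_iff hM]
  simp

lemma isStoppingTime_blockTime {M : ℕ} {R : Set (ℕ → X)}
    (hR : MeasurableSet[obsFiltration X M] R) :
    IsStoppingTime (obsFiltration X) (blockTime M R) := by
  intro n
  have : {ω : ℕ → X | blockTime M R ω ≤ (n : ℕ∞)}
      = ⋃ j, ⋃ _ : (j + 1) * M ≤ n, shift (j * M) ⁻¹' R := by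
    ext ω
    simp only [Set.mem_ofPred_eq, blockTime_le_iff, Set.mem_iUnion, Set.mem_preimage, exists_prop]
  change MeasurableSet[obsFiltration X n] {ω : ℕ → X | blockTime M R ω ≤ (n : ℕ∞)}
  rw [this]
  refine MeasurableSet.iUnion fun j => MeasurableSet.iUnion fun hj => ?_
  refine coordSigma_mono (fun l hl => ?_) _ (measurableSet_shift_preimage hR)
  have h2 := hl.2
  rw [add_mul, one_mul] at hj
  exact lt_of_lt_of_le h2 hj

/-- When finite, `blockTime` is a multiple of `M`, so the count in `toENNReal_le_tsum` does not
overshoot. -/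
lemma tsum_le_blockTime {X : Type*} (M : ℕ) (R : Set (ℕ → X)) (ω : ℕ → X) :
    ∑' i : ℕ, (M : ℝ≥0∞) * (if ((i * M : ℕ) : ℕ∞) < blockTime M R ω then 1 else 0)
      ≤ (blockTime M R ω : ℝ≥0∞) := by
  rcases eq_or_ne (blockTime M R ω) ⊤ with h | h
  · rw [h]; exact le_top
  obtain ⟨n, hn⟩ := ENat.ne_top_iff_exists.1 h
  obtain ⟨j, hj, hjR⟩ := blockTime_le_iff.1 hn.symm.le
  have hle : blockTime M R ω ≤ (((j + 1) * M : ℕ) : ℕ∞) := blockTime_le_iff.2 ⟨j, le_rfl, hjR⟩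
  have hn' : n = (j + 1) * M := le_antisymm (by rw [← hn] at hle; exact_mod_cast hle) hj
  rw [← hn, hn', tsum_eq_sum (s := Finset.range (j + 1))]
  · calc _ ≤ ∑ _i ∈ Finset.range (j + 1), (M : ℝ≥0∞) :=
          Finset.sum_le_sum fun i _ => by split_ifs <;> simp
      _ = _ := by simp
  · intro i hi
    rw [if_neg, mul_zero]
    rw [Finset.mem_range, not_lt] at hi
    rw [not_lt]
    exact_mod_cast Nat.mul_le_mul_right M hi

lemma lintegral_tsum_lt {T : (ℕ → X) → ℕ∞} (hT : IsStoppingTime (obsFiltration X) T)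
    (m s : ℕ) (P : Measure (ℕ → X)) :
    ∫⁻ ω, ∑' i : ℕ, (m : ℝ≥0∞) * (if ((i * m : ℕ) : ℕ∞) < T ω - s then 1 else 0) ∂P
      = ∑' i : ℕ, m * P {ω | ((i * m + s : ℕ) : ℕ∞) < T ω} := by
  have hind : ∀ i : ℕ, (fun ω => (m : ℝ≥0∞) * (if ((i * m : ℕ) : ℕ∞) < T ω - s then 1 else 0))
      = {ω | ((i * m + s : ℕ) : ℕ∞) < T ω}.indicator fun _ => (m : ℝ≥0∞) := fun i => by
    funext ω
    rw [Set.indicator]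
    simp only [Set.mem_ofPred_eq, lt_tsub_iff_right, Nat.cast_add, mul_ite, mul_one, mul_zero]
  rw [lintegral_tsum fun i => by
    rw [hind]
    exact (measurable_const.indicator (measurable_stopping hT _)).aemeasurable]
  refine tsum_congr fun i => ?_
  rw [hind, lintegral_indicator (measurable_stopping hT _), setLIntegral_const]

/-- The number of blocks used is geometric with success probability P(R). -/
lemma lintegral_blockTime_ge (h₀ : IsPDF ν q₀) {M : ℕ} (hM : 0 < M) {R : Set (ℕ → X)}
    (hR : MeasurableSet[obsFiltration X M] R) :
    M * (iidLaw ν q₀ R)⁻¹ ≤ ∫⁻ ω, (blockTime M R ω : ℝ≥0∞) ∂(iidLaw ν q₀) := by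
  have := isProbabilityMeasure_iidLaw h₀
  have h1 := lintegral_tsum_lt (isStoppingTime_blockTime hR) M 0 (iidLaw ν q₀)
  simp only [Nat.cast_zero, tsub_zero, add_zero] at h1
  refine le_trans (le_of_eq ?_) (lintegral_mono fun ω => tsum_le_blockTime M R ω)
  have h2 : ∀ i : ℕ, {ω | ((i * M : ℕ) : ℕ∞) < blockTime M R ω} = blockEvent M Rᶜ 0 i :=
    fun i => by ext ω; exact lt_blockTime_iff hM
  rw [h1]
  simp only [h2, iidLaw_blockEvent h₀ hR.compl]
  rw [ENNReal.tsum_mul_left, ENNReal.tsum_geometric, prob_compl_eq_one_sub (measurableSet_obs hR),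
    ENNReal.sub_sub_cancel ENNReal.one_ne_top prob_le_one]

/-- The block in progress at the change is discarded, at a cost of at most `M`. The later blocks are
independent of the past and follow the law after the change, so a geometric number of them suffices.
-/
lemma worstDelay_blockTime_le (h₀ : IsPDF ν q₀) (h₁ : IsPDF ν q₁) {M : ℕ} (hM : 0 < M)
    {R : Set (ℕ → X)} (hR : MeasurableSet[obsFiltration X M] R) :
    worstDelay ν q₀ q₁ (blockTime M R) ≤ M + M * (iidLaw ν q₁ R)⁻¹ := by
  have := isProbabilityMeasure_iidLaw h₁
  refine worstDelay_le h₀ h₁ _ _ fun s B hB => ?_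
  have := isProbabilityMeasure_changeLaw h₀ h₁ (s + 1)
  have := isProbabilityMeasure_ite h₀ h₁ (s + 1)
  set P := changeLaw ν q₀ q₁ (s + 1) with hP
  set i := s / M + 1 with hi
  have hdm := Nat.div_add_mod s M
  have hml := Nat.mod_lt s hM
  have hiM : i * M = M * (s / M) + M := by rw [hi]; ring
  have hsi : s ≤ i * M := by omega
  have his : i * M ≤ s + M := by omega
  have hst := isStoppingTime_blockTime hR
  have hpt : ∀ ω : ℕ → X, ((blockTime M R ω - s : ℕ∞) : ℝ≥0∞)
      ≤ M + ∑' n : ℕ, (M : ℝ≥0∞) *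
        (if ((n * M : ℕ) : ℕ∞) < blockTime M R ω - (i * M : ℕ) then 1 else 0) := by
    intro ω
    have h1 : blockTime M R ω - s ≤ M + (blockTime M R ω - (i * M : ℕ)) := by
      rw [tsub_le_iff_right]
      calc blockTime M R ω ≤ (blockTime M R ω - (i * M : ℕ)) + (i * M : ℕ) := le_tsub_add
        _ ≤ (blockTime M R ω - (i * M : ℕ)) + (s + M : ℕ) := by gcongr
        _ = _ := by push_cast; ring
    refine (ENat.toENNReal_le.2 h1).trans ?_
    rw [ENat.toENNReal_add, ENat.toENNReal_coe]
    gcongr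
    exact toENNReal_le_tsum hM _
  have hsurv : ∀ n : ℕ, P.restrict B {ω | ((n * M + i * M : ℕ) : ℕ∞) < blockTime M R ω}
      ≤ P B * (iidLaw ν q₁ Rᶜ) ^ n := by
    intro n
    rw [Measure.restrict_apply (measurable_stopping hst _), Set.inter_comm]
    have hsub : {ω | ((n * M + i * M : ℕ) : ℕ∞) < blockTime M R ω} ⊆ blockEvent M Rᶜ i n := by
      intro ω hω
      rw [Set.mem_ofPred_eq, ← add_mul, lt_blockTime_iff hM] at hω
      exact fun j hj hj' => hω j (Nat.zero_le _) (by omega)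
    refine (measure_mono (Set.inter_subset_inter_right _ hsub)).trans (le_of_eq ?_)
    refine measure_inter_blockEvent _ hsi hR.compl hB (fun j hj => ?_) n
    change changeLaw ν q₀ q₁ (s + 1) _ = _
    have hsj : s ≤ j * M := hsi.trans (Nat.mul_le_mul_right M hj)
    rw [← Measure.map_apply (measurable_shift _) (measurableSet_obs hR).compl,
      map_shift_changeLaw h₀ h₁ (by omega)]
  calc ∫⁻ ω in B, ((blockTime M R ω - s : ℕ∞) : ℝ≥0∞) ∂P
      ≤ ∫⁻ ω in B, (M + ∑' n : ℕ, (M : ℝ≥0∞) *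
        (if ((n * M : ℕ) : ℕ∞) < blockTime M R ω - (i * M : ℕ) then 1 else 0)) ∂P :=
        lintegral_mono hpt
    _ = M * P B + ∑' n : ℕ,
        M * P.restrict B {ω | ((n * M + i * M : ℕ) : ℕ∞) < blockTime M R ω} := by
        rw [lintegral_add_left measurable_const, setLIntegral_const, lintegral_tsum_lt hst]
    _ ≤ M * P B + ∑' n : ℕ, M * (P B * (iidLaw ν q₁ Rᶜ) ^ n) := by
        gcongr with n
        exact hsurv n
    _ = (M + M * (iidLaw ν q₁ R)⁻¹) * P B := by
        rw [ENNReal.tsum_mul_left, ENNReal.tsum_mul_left, ENNReal.tsum_geometric,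
          prob_compl_eq_one_sub (measurableSet_obs hR),
          ENNReal.sub_sub_cancel ENNReal.one_ne_top prob_le_one]
        ring

/-- Upper bound for the optimal delay from a test on blocks of length `m` with level `α` and power
`β`, applied to `K` consecutive blocks. -/
lemma optDelay_le_of_test (h₀ : IsPDF ν q₀) (h₁ : IsPDF ν q₁) {m K : ℕ} (hm : 0 < m)
    (hK : 0 < K) {Y : Set (ℕ → X)} (hY : MeasurableSet[obsFiltration X m] Y) {α β : ℝ≥0∞}
    (hα : iidLaw ν q₀ Y ≤ α) (hβ : β ≤ iidLaw ν q₁ Y) {γ : ℝ}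
    (hγ : ENNReal.ofReal γ ≤ (K * m : ℕ) * (α ^ K)⁻¹) :
    optDelay ν q₀ q₁ γ ≤ (K * m : ℕ) + (K * m : ℕ) * (β ^ K)⁻¹ := by
  have hR := measurableSet_blockEvent hY 0 K
  rw [zero_add] at hR
  have hM : 0 < K * m := Nat.mul_pos hK hm
  -- A long block raises the alarm only if all its `K` subblocks lie in `Y`, which turns level and
  -- power into `K`-th powers.
  refine iInf₂_le_of_le (blockTime (K * m) (blockEvent m Y 0 K))
    ⟨isStoppingTime_blockTime hR, ?_⟩ ?_
  · refine le_trans (hγ.trans ?_) (lintegral_blockTime_ge h₀ hM hR)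
    rw [iidLaw_blockEvent h₀ hY]
    gcongr
  · refine (worstDelay_blockTime_le h₀ h₁ hM hR).trans ?_
    rw [iidLaw_blockEvent h₁ hY]
    gcongr

end Blocks

/-! ### The sequential probability ratio test -/

section Sprt

variable {X : Type*} [MeasurableSpace X] {ν : Measure X} {q₀ q₁ : X → ℝ}

lemma RegularPair.isStoppingTime_sprtTime (h : RegularPair ν q₀ q₁) (a b : ℝ) :
    IsStoppingTime (obsFiltration X) (sprtTime q₀ q₁ a b) := by
  have : Adapted (obsFiltration X) (llrWalk q₀ q₁) := fun n => h.measurable_llrWalk le_rfl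
  exact this.isStoppingTime_hittingAfter measurableSet_Ioo.compl

lemma one_le_sprtTime {X : Type*} (q₀ q₁ : X → ℝ) (a b : ℝ) (ω : ℕ → X) :
    1 ≤ sprtTime q₀ q₁ a b ω :=
  le_hittingAfter (u := llrWalk q₀ q₁) (s := (Set.Ioo a b)ᶜ) (n := 1) ω

lemma llrWalk_mem_of_lt {X : Type*} {q₀ q₁ : X → ℝ} {a b : ℝ} (ha : a < 0) (hb : 0 < b)
    {n : ℕ} {ω : ℕ → X} (hn : (n : ℕ∞) < sprtTime q₀ q₁ a b ω) :
    a < llrWalk q₀ q₁ n ω ∧ llrWalk q₀ q₁ n ω < b := by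
  -- The test ignores time 0, where the walk is 0 and lies in the interval because a < 0 < b.
  rcases Nat.eq_zero_or_pos n with rfl | h
  · simp [llrWalk, ha, hb]
  · have := notMem_of_lt_hittingAfter (u := llrWalk q₀ q₁) (s := (Set.Ioo a b)ᶜ) (n := 1) hn h
    simpa using this

lemma llrWalk_notMem_of_eq {X : Type*} {q₀ q₁ : X → ℝ} {a b : ℝ} {n : ℕ} {ω : ℕ → X}
    (hn : sprtTime q₀ q₁ a b ω = n) :
    sprtValue q₀ q₁ a b ω = llrWalk q₀ q₁ n ω ∧ llrWalk q₀ q₁ n ω ∉ Set.Ioo a b := by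
  have h1 : (sprtTime q₀ q₁ a b ω).untopA = n := by rw [hn]; rfl
  have h2 : sprtTime q₀ q₁ a b ω ≠ ⊤ := by rw [hn]; simp
  have h3 := hittingAfter_mem_set_of_ne_top (u := llrWalk q₀ q₁) (s := (Set.Ioo a b)ᶜ) h2
  change llrWalk q₀ q₁ (sprtTime q₀ q₁ a b ω).untopA ω ∈ _ at h3
  rw [h1] at h3
  refine ⟨?_, h3⟩
  change llrWalk q₀ q₁ (sprtTime q₀ q₁ a b ω).untopA ω = _
  rw [h1]

/-- If the test never ends, `untopA` returns some natural number, and the walk is below `b` at every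
finite time. -/
lemma sprtValue_lt_of_eq_top {X : Type*} {q₀ q₁ : X → ℝ} {a b : ℝ} (ha : a < 0) (hb : 0 < b)
    {ω : ℕ → X} (h : sprtTime q₀ q₁ a b ω = ⊤) : sprtValue q₀ q₁ a b ω < b := by
  exact (llrWalk_mem_of_lt ha hb (by rw [h]; exact ENat.natCast_lt_top _)).2

lemma RegularPair.measurable_sprtValue (h : RegularPair ν q₀ q₁) (a b : ℝ) :
    Measurable (sprtValue q₀ q₁ a b) := by
  have hst := h.isStoppingTime_sprtTime a b
  have htop : MeasurableSet {ω | sprtTime q₀ q₁ a b ω = ⊤} := by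
    have : {ω | sprtTime q₀ q₁ a b ω = ⊤} = ⋂ n : ℕ, {ω | (n : ℕ∞) < sprtTime q₀ q₁ a b ω} := by
      ext ω
      simp only [Set.mem_ofPred_eq, Set.mem_iInter]
      exact ENat.eq_top_iff_forall_gt
    rw [this]
    exact MeasurableSet.iInter fun n => measurable_stopping hst n
  have hσ : Measurable fun ω => (sprtTime q₀ q₁ a b ω).untopA := by
    refine measurable_to_countable' fun n => ?_
    have : (fun ω => (sprtTime q₀ q₁ a b ω).untopA) ⁻¹' {n}
        = {ω | sprtTime q₀ q₁ a b ω = (n : ℕ∞)} ∪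
          ({ω | sprtTime q₀ q₁ a b ω = ⊤} ∩ {_ω | (⊤ : WithTop ℕ).untopA = n}) := by
      ext ω
      simp only [Set.mem_preimage, Set.mem_singleton_iff, Set.mem_union, Set.mem_inter_iff,
        Set.mem_ofPred_eq]
      induction hτ : sprtTime q₀ q₁ a b ω using ENat.recTopCoe with
      | top =>
        simp only [ENat.top_ne_natCast, true_and, false_or]
        rfl
      | coe k =>
        have : (((k : ℕ∞) : WithTop ℕ)).untopA = k := rfl
        rw [this]
        simp
    rw [this]
    exact (measurableSet_obs (hst.measurableSet_eq n)).union (htop.inter (.const _))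
  have : Measurable fun p : ℕ × (ℕ → X) => llrWalk q₀ q₁ p.1 p.2 :=
    measurable_from_prod_countable_right fun n => h.measurable_llrWalk' n
  exact this.comp (hσ.prodMk measurable_id)

/-- The sum of `f (ω j)` over the `j < N` before the end of the test. -/
noncomputable def sprtSum (q₀ q₁ : X → ℝ) (a b : ℝ) (f : X → ℝ) (N : ℕ) (ω : ℕ → X) : ℝ :=
  ∑ j ∈ Finset.range N, {ω | (j : ℕ∞) < sprtTime q₀ q₁ a b ω}.indicator (fun ω => f (ω j)) ω

omit [MeasurableSpace X] in
lemma sprtSum_of_le {a b : ℝ} (f : X → ℝ) {N : ℕ} {ω : ℕ → X}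
    (hN : (N : ℕ∞) ≤ sprtTime q₀ q₁ a b ω) :
    sprtSum q₀ q₁ a b f N ω = ∑ j ∈ Finset.range N, f (ω j) :=
  Finset.sum_congr rfl fun j hj => Set.indicator_of_mem
    (show ω ∈ {ω | (j : ℕ∞) < sprtTime q₀ q₁ a b ω} from
      lt_of_lt_of_le (Nat.cast_lt.2 (Finset.mem_range.1 hj)) hN) _

omit [MeasurableSpace X] in
lemma sprtSum_of_eq {a b : ℝ} (f : X → ℝ) {n N : ℕ} (hnN : n ≤ N) {ω : ℕ → X}
    (hn : sprtTime q₀ q₁ a b ω = n) :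
    sprtSum q₀ q₁ a b f N ω = ∑ j ∈ Finset.range n, f (ω j) := by
  rw [← sprtSum_of_le f hn.symm.le, sprtSum, sprtSum]
  refine (Finset.sum_subset (Finset.range_mono hnN) fun j _ hj => ?_).symm
  refine Set.indicator_of_notMem ?_ _
  rw [Finset.mem_range, not_lt] at hj
  rw [Set.mem_ofPred_eq, hn, not_lt]
  exact_mod_cast hj

/-- Wald's identity for the truncated test. -/
lemma RegularPair.integral_sprtSum (h : RegularPair ν q₀ q₁) (a b : ℝ) {f : X → ℝ}
    (hf : Measurable f) (hfi : Integrable f (obsDist ν q₁)) (N : ℕ) :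
    Integrable (sprtSum q₀ q₁ a b f N) (iidLaw ν q₁) ∧
    ∫ ω, sprtSum q₀ q₁ a b f N ω ∂(iidLaw ν q₁) = (∫ x, f x ∂(obsDist ν q₁)) *
      ∑ j ∈ Finset.range N, (iidLaw ν q₁).real {ω | (j : ℕ∞) < sprtTime q₀ q₁ a b ω} := by
  have := h.pdf₁.isProbabilityMeasure
  have := isProbabilityMeasure_iidLaw h.pdf₁
  have hst := h.isStoppingTime_sprtTime a b
  have hfj : ∀ j, Integrable (fun ω : ℕ → X => f (ω j)) (iidLaw ν q₁) := fun j =>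
    (measurePreserving_coord h.pdf₁ j).integrable_comp_of_integrable hfi
  have hi : ∀ j ∈ Finset.range N, Integrable
      ({ω | (j : ℕ∞) < sprtTime q₀ q₁ a b ω}.indicator fun ω => f (ω j)) (iidLaw ν q₁) :=
    fun j _ => (hfj j).indicator (measurable_stopping hst j)
  refine ⟨integrable_finsetSum _ hi, ?_⟩
  simp only [sprtSum]
  rw [integral_finsetSum _ hi, Finset.mul_sum]
  refine Finset.sum_congr rfl fun j _ => ?_
  set U := {ω | (j : ℕ∞) < sprtTime q₀ q₁ a b ω}
  have hU : MeasurableSet[obsFiltration X j] U := measurableSet_lt_stopping hst j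
  -- Whether the test continues past time `j` is decided by the coordinates below `j`, hence
  -- independently of `ω j`.
  have hind : IndepFun (U.indicator fun _ => (1 : ℝ)) (fun ω : ℕ → X => f (ω j))
      (iidLaw ν q₁) := by
    rw [IndepFun_iff_Indep]
    have hd : Disjoint (Set.Iio j) {j} := by simp
    refine indep_of_indep_of_le_left (indep_of_indep_of_le_right
      (indep_coordSigma (fun _ => obsDist ν q₁) hd) ?_) ?_
    · exact measurable_iff_comap_le.1 (hf.comp (measurable_coord (Set.mem_singleton j)))
    · exact measurable_iff_comap_le.1
        (Measurable.indicator (@measurable_const _ _ _ (obsFiltration X j) _) hU)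
  have hprod : (U.indicator fun ω : ℕ → X => f (ω j))
      = fun ω => U.indicator (fun _ => (1 : ℝ)) ω * f (ω j) := by
    funext ω
    by_cases hω : ω ∈ U <;> simp [hω]
  rw [hprod, hind.integral_fun_mul_eq_mul_integral
    ((measurable_const.indicator (measurableSet_obs hU)).aestronglyMeasurable)
    (hfj j).aestronglyMeasurable, integral_indicator (measurableSet_obs hU), setIntegral_const,
    smul_eq_mul, mul_one, mul_comm]
  congr 1
  rw [← (measurePreserving_coord h.pdf₁ j).map_eq,
    integral_map (measurable_pi_apply j).aemeasurable hf.aestronglyMeasurable]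

omit [MeasurableSpace X] in
/-- With increments cut off at `c`, the walk stopped by the test stays below `b + c`. -/
lemma sprtSum_min_le {a b c : ℝ} (ha : a < 0) (hb : 0 < b) (hc : 0 ≤ c) (N : ℕ) (ω : ℕ → X) :
    sprtSum q₀ q₁ a b (fun x => min (llRatio q₀ q₁ x) c) N ω ≤ b + c := by
  have key : ∀ n : ℕ, (n : ℕ∞) ≤ sprtTime q₀ q₁ a b ω →
      ∑ j ∈ Finset.range n, min (llRatio q₀ q₁ (ω j)) c ≤ b + c := by
    intro n hn
    rcases n with _ | n
    · simpa using by linarith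
    · rw [Finset.sum_range_succ]
      have h1 : (n : ℕ∞) < sprtTime q₀ q₁ a b ω :=
        lt_of_lt_of_le (Nat.cast_lt.2 (Nat.lt_succ_self n)) hn
      -- One step earlier the full walk, which dominates the truncated one, is below `b`; the last
      -- truncated increment adds at most `c`.
      have h2 := (llrWalk_mem_of_lt ha hb h1).2
      have h3 : ∑ j ∈ Finset.range n, min (llRatio q₀ q₁ (ω j)) c ≤ llrWalk q₀ q₁ n ω :=
        Finset.sum_le_sum fun j _ => min_le_left _ _
      have h4 := min_le_right (llRatio q₀ q₁ (ω n)) c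
      linarith
  rcases le_or_gt (N : ℕ∞) (sprtTime q₀ q₁ a b ω) with hN | hN
  · rw [sprtSum_of_le _ hN]
    exact key N hN
  · obtain ⟨n, hn⟩ := ENat.ne_top_iff_exists.1 (ne_top_of_lt hN)
    have hnN : n < N := by rw [← hn] at hN; exact_mod_cast hN
    rw [sprtSum_of_eq _ hnN.le hn.symm]
    exact key n hn.le

/-- By dominated convergence the truncated drift tends to D(q₁‖q₀) > 0. With bounded upward jumps,
Wald's identity bounds the expected duration before anything is known about the overshoot. -/
lemma RegularPair.exists_integral_min_pos (h : RegularPair ν q₀ q₁)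
    (hD : 0 < (kl ν q₁ q₀).toReal) :
    ∃ c : ℕ, Integrable (fun x => min (llRatio q₀ q₁ x) c) (obsDist ν q₁) ∧
      0 < ∫ x, min (llRatio q₀ q₁ x) (c : ℝ) ∂(obsDist ν q₁) := by
  have := h.pdf₁.isProbabilityMeasure
  obtain ⟨h1, h2⟩ := h.integral_llRatio_right
  have hle : ∀ (c : ℕ) (x : X), ‖min (llRatio q₀ q₁ x) (c : ℝ)‖ ≤ ‖llRatio q₀ q₁ x‖ := by
    intro c x
    have hc : (0 : ℝ) ≤ c := Nat.cast_nonneg c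
    rcases le_total (llRatio q₀ q₁ x) c with hx | hx
    · rw [min_eq_left hx]
    · rw [min_eq_right hx, Real.norm_of_nonneg hc, Real.norm_of_nonneg (hc.trans hx)]
      exact hx
  have hm : ∀ c : ℕ, AEStronglyMeasurable (fun x => min (llRatio q₀ q₁ x) (c : ℝ))
      (obsDist ν q₁) := fun c => (h.measurable_llRatio.min measurable_const).aestronglyMeasurable
  have hlim : Tendsto (fun c : ℕ => ∫ x, min (llRatio q₀ q₁ x) (c : ℝ) ∂(obsDist ν q₁)) atTop
      (𝓝 (∫ x, llRatio q₀ q₁ x ∂(obsDist ν q₁))) := by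
    refine tendsto_integral_of_dominated_convergence (fun x => ‖llRatio q₀ q₁ x‖) hm h1.norm
      (fun c => ae_of_all _ (hle c)) (ae_of_all _ fun x => ?_)
    refine tendsto_const_nhds.congr' ?_
    filter_upwards [eventually_ge_atTop ⌈llRatio q₀ q₁ x⌉₊] with c hc
    exact (min_eq_left ((Nat.le_ceil _).trans (Nat.cast_le.2 hc))).symm
  rw [h2] at hlim
  obtain ⟨c, hc⟩ := (hlim.eventually (lt_mem_nhds hD)).exists
  exact ⟨c, h1.mono (hm c) (ae_of_all _ (hle c)), hc⟩

/-- The expected duration of the test is finite. -/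
lemma RegularPair.tsum_sprtTime_ne_top (h : RegularPair ν q₀ q₁) {a b : ℝ} (ha : a < 0)
    (hb : 0 < b) (hD : 0 < (kl ν q₁ q₀).toReal) :
    ∑' j : ℕ, iidLaw ν q₁ {ω | (j : ℕ∞) < sprtTime q₀ q₁ a b ω} ≠ ∞ := by
  have := isProbabilityMeasure_iidLaw h.pdf₁
  obtain ⟨c, hci, hc⟩ := h.exists_integral_min_pos hD
  have hbd : ∀ N : ℕ, ∑ j ∈ Finset.range N,
      (iidLaw ν q₁).real {ω | (j : ℕ∞) < sprtTime q₀ q₁ a b ω}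
        ≤ (b + c) / ∫ x, min (llRatio q₀ q₁ x) (c : ℝ) ∂(obsDist ν q₁) := by
    intro N
    obtain ⟨h1, h2⟩ := h.integral_sprtSum a b (h.measurable_llRatio.min measurable_const) hci N
    rw [le_div_iff₀' hc, ← h2]
    refine (integral_mono h1 (integrable_const (b + (c : ℝ)))
      fun ω => sprtSum_min_le ha hb (Nat.cast_nonneg c) N ω).trans ?_
    simp
  have hs := summable_of_sum_range_le (fun _ => measureReal_nonneg) hbd
  have : ∀ j : ℕ, iidLaw ν q₁ {ω | (j : ℕ∞) < sprtTime q₀ q₁ a b ω}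
      = ENNReal.ofReal ((iidLaw ν q₁).real {ω | (j : ℕ∞) < sprtTime q₀ q₁ a b ω}) :=
    fun j => by rw [ofReal_measureReal]
  simp only [this]
  exact hs.tsum_ofReal_ne_top

/-- The overshoot of the test over the upper threshold. -/
noncomputable def overshoot (q₀ q₁ : X → ℝ) (a b : ℝ) : (ℕ → X) → ℝ :=
  {ω | b ≤ sprtValue q₀ q₁ a b ω}.indicator fun ω => sprtValue q₀ q₁ a b ω - b

omit [MeasurableSpace X] in
lemma overshoot_nonneg (a b : ℝ) (ω : ℕ → X) : 0 ≤ overshoot q₀ q₁ a b ω :=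
  Set.indicator_nonneg (fun _ hω => sub_nonneg.2 hω) ω

-- The overshoot is at most the last increment. Summing over all steps taken avoids evaluating an
-- increment at a random time.
omit [MeasurableSpace X] in
lemma ofReal_overshoot_le {a b : ℝ} (ha : a < 0) (hb : 0 < b) (ω : ℕ → X) :
    ENNReal.ofReal (overshoot q₀ q₁ a b ω)
      ≤ ∑' j : ℕ, {ω | (j : ℕ∞) < sprtTime q₀ q₁ a b ω}.indicator
          (fun ω => ENNReal.ofReal |llRatio q₀ q₁ (ω j)|) ω := by
  by_cases hA : b ≤ sprtValue q₀ q₁ a b ω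
  · have hne : sprtTime q₀ q₁ a b ω ≠ ⊤ := fun ht =>
      absurd (sprtValue_lt_of_eq_top ha hb ht) (not_lt.2 hA)
    obtain ⟨n, hn⟩ := ENat.ne_top_iff_exists.1 hne
    obtain ⟨k, rfl⟩ : ∃ k, n = k + 1 := by
      have := one_le_sprtTime q₀ q₁ a b ω
      rw [← hn] at this
      exact ⟨n - 1, by have : 1 ≤ n := by exact_mod_cast this
                       omega⟩
    have hlt : (k : ℕ∞) < sprtTime q₀ q₁ a b ω := by
      rw [← hn]; exact_mod_cast Nat.lt_succ_self k
    refine le_trans ?_ (ENNReal.le_tsum k)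
    rw [Set.indicator_of_mem (show ω ∈ {ω | (k : ℕ∞) < sprtTime q₀ q₁ a b ω} from hlt)]
    refine ENNReal.ofReal_le_ofReal ?_
    rw [overshoot, Set.indicator_of_mem (show ω ∈ {ω | b ≤ sprtValue q₀ q₁ a b ω} from hA),
      (llrWalk_notMem_of_eq hn.symm).1, llrWalk_eq, Finset.sum_range_succ, ← llrWalk_eq]
    have := (llrWalk_mem_of_lt ha hb hlt).2
    have := le_abs_self (llRatio q₀ q₁ (ω k))
    linarith
  · rw [overshoot, Set.indicator_of_notMem (show ω ∉ {ω | b ≤ sprtValue q₀ q₁ a b ω} from hA)]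
    simp

/-- Without integrability the Bochner integral would be 0 by default and a bound on the mean
overshoot would say nothing. The dominating sum has mean E[T] · E|log(q₁/q₀)|, by independence of
each increment from the past. -/
lemma RegularPair.integrable_overshoot (h : RegularPair ν q₀ q₁) {a b : ℝ} (ha : a < 0)
    (hb : 0 < b) (hD : 0 < (kl ν q₁ q₀).toReal) :
    Integrable (overshoot q₀ q₁ a b) (iidLaw ν q₁) := by
  have := h.pdf₁.isProbabilityMeasure
  have hst := h.isStoppingTime_sprtTime a b
  have hV := h.measurable_sprtValue a b
  have hm : Measurable (overshoot q₀ q₁ a b) :=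
    (hV.sub_const b).indicator (measurableSet_le measurable_const hV)
  have habs : Measurable fun x => ENNReal.ofReal |llRatio q₀ q₁ x| :=
    h.measurable_llRatio.abs.ennreal_ofReal
  rw [← lintegral_ofReal_ne_top_iff_integrable hm.aestronglyMeasurable
    (ae_of_all _ (overshoot_nonneg a b))]
  refine ne_top_of_le_ne_top ?_ (lintegral_mono (ofReal_overshoot_le ha hb))
  have hmj : ∀ j : ℕ, Measurable fun ω : ℕ → X => ENNReal.ofReal |llRatio q₀ q₁ (ω j)| :=
    fun j => habs.comp (measurable_pi_apply j)
  rw [lintegral_tsum fun j => ((hmj j).indicator (measurable_stopping hst j)).aemeasurable]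
  have hterm : ∀ j : ℕ, ∫⁻ ω, {ω | (j : ℕ∞) < sprtTime q₀ q₁ a b ω}.indicator
      (fun ω => ENNReal.ofReal |llRatio q₀ q₁ (ω j)|) ω ∂(iidLaw ν q₁)
      = iidLaw ν q₁ {ω | (j : ℕ∞) < sprtTime q₀ q₁ a b ω} *
        ∫⁻ x, ENNReal.ofReal |llRatio q₀ q₁ x| ∂(obsDist ν q₁) := by
    intro j
    set U := {ω | (j : ℕ∞) < sprtTime q₀ q₁ a b ω}
    have hU : MeasurableSet[obsFiltration X j] U := measurableSet_lt_stopping hst j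
    have hd : Disjoint (Set.Iio j) {j} := by simp
    have hprod : (fun ω : ℕ → X => U.indicator
        (fun ω => ENNReal.ofReal |llRatio q₀ q₁ (ω j)|) ω)
        = fun ω => U.indicator (fun _ => 1) ω * ENNReal.ofReal |llRatio q₀ q₁ (ω j)| := by
      funext ω
      by_cases hω : ω ∈ U <;> simp [hω]
    rw [hprod]
    refine (lintegral_mul_eq_lintegral_mul_lintegral_of_independent_measurableSpace
      (coordSigma_le _) (coordSigma_le _) (indep_coordSigma (fun _ => obsDist ν q₁) hd)
      (measurable_const.indicator hU)
      (habs.comp (measurable_coord (Set.mem_singleton j)))).trans ?_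
    congr 1
    · rw [lintegral_indicator (measurableSet_obs hU), setLIntegral_const, one_mul]
      rfl
    · exact (measurePreserving_coord h.pdf₁ j).lintegral_comp habs
  simp only [hterm]
  rw [ENNReal.tsum_mul_right]
  refine ENNReal.mul_ne_top (h.tsum_sprtTime_ne_top ha hb hD) ?_
  rw [lintegral_ofReal_ne_top_iff_integrable h.measurable_llRatio.abs.aestronglyMeasurable
    (ae_of_all _ fun _ => abs_nonneg _)]
  exact h.integral_llRatio_right.1.abs

lemma RegularPair.integral_overshoot_le (h : RegularPair ν q₀ q₁) {a b : ℝ}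
    (hos : condMean (iidLaw ν q₁) (fun ω => sprtValue q₀ q₁ a b ω - b)
      {ω | b ≤ sprtValue q₀ q₁ a b ω} ≤ 1) :
    ∫ ω, overshoot q₀ q₁ a b ω ∂(iidLaw ν q₁) ≤ 1 := by
  have := isProbabilityMeasure_iidLaw h.pdf₁
  have hA : MeasurableSet {ω | b ≤ sprtValue q₀ q₁ a b ω} :=
    measurableSet_le measurable_const (h.measurable_sprtValue a b)
  simp only [overshoot]
  rw [integral_indicator hA]
  rw [condMean, ProbabilityTheory.cond, integral_smul_measure] at hos
  set A := {ω | b ≤ sprtValue q₀ q₁ a b ω}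
  set I := ∫ ω in A, (sprtValue q₀ q₁ a b ω - b) ∂(iidLaw ν q₁)
  -- If the upper threshold is almost never reached, the conditional mean carries no information,
  -- but the integral is 0.
  rcases eq_or_ne (iidLaw ν q₁ A) 0 with h0 | h0
  · have : I = 0 := by
      simp only [I, Measure.restrict_eq_zero.2 h0, integral_zero_measure]
    rw [this]; norm_num
  · rw [ENNReal.toReal_inv, smul_eq_mul, inv_mul_le_iff₀
      (ENNReal.toReal_pos h0 (measure_ne_top _ _)), mul_one] at hos
    exact hos.trans measureReal_le_one

/-- The acceptance region of the test for the law after the change, within `N` observations. -/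
def sprtAccept (q₀ q₁ : X → ℝ) (a b : ℝ) (N : ℕ) : Set (ℕ → X) :=
  ⋃ n ∈ Finset.range (N + 1), {ω | sprtTime q₀ q₁ a b ω = (n : ℕ∞) ∧ b ≤ llrWalk q₀ q₁ n ω}

lemma RegularPair.measurableSet_sprtAccept_aux (h : RegularPair ν q₀ q₁) (a b : ℝ) (n : ℕ) :
    MeasurableSet[obsFiltration X n]
      {ω | sprtTime q₀ q₁ a b ω = (n : ℕ∞) ∧ b ≤ llrWalk q₀ q₁ n ω} :=
  MeasurableSet.inter ((h.isStoppingTime_sprtTime a b).measurableSet_eq n)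
    (h.measurable_llrWalk le_rfl measurableSet_Ici)

lemma RegularPair.measurableSet_sprtAccept (h : RegularPair ν q₀ q₁) (a b : ℝ) (N : ℕ) :
    MeasurableSet[obsFiltration X N] (sprtAccept q₀ q₁ a b N) :=
  Finset.measurableSet_biUnion _ fun n hn =>
    (obsFiltration X).mono (Nat.lt_succ_iff.1 (Finset.mem_range.1 hn)) _
      (h.measurableSet_sprtAccept_aux a b n)

/-- The level of the test. -/
lemma RegularPair.iidLaw_sprtAccept_le (h : RegularPair ν q₀ q₁) (a b : ℝ) (N : ℕ) :
    iidLaw ν q₀ (sprtAccept q₀ q₁ a b N) ≤ ENNReal.ofReal (Real.exp (-b)) := by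
  have := isProbabilityMeasure_iidLaw h.pdf₁
  have hm := fun n => measurableSet_obs (h.measurableSet_sprtAccept_aux a b n)
  have hd : Set.PairwiseDisjoint (↑(Finset.range (N + 1)))
      fun n : ℕ => {ω | sprtTime q₀ q₁ a b ω = (n : ℕ∞) ∧ b ≤ llrWalk q₀ q₁ n ω} := by
    intro i _ j _ hij
    refine Set.disjoint_left.2 fun ω hi hj => hij ?_
    have := hi.1.symm.trans hj.1
    exact_mod_cast this
  -- On each piece the likelihood ratio at the stopping time is at least e^b, and the pieces are
  -- disjoint under q₁.
  have h1 : ENNReal.ofReal (Real.exp b) * iidLaw ν q₀ (sprtAccept q₀ q₁ a b N) ≤ 1 := by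
    refine le_trans ?_ (prob_le_one (μ := iidLaw ν q₁) (s := sprtAccept q₀ q₁ a b N))
    rw [sprtAccept, measure_biUnion_finset hd fun n _ => hm n,
      measure_biUnion_finset hd fun n _ => hm n, Finset.mul_sum]
    refine Finset.sum_le_sum fun n _ => ?_
    have h2 := h.measurableSet_sprtAccept_aux a b n
    rw [← zero_add n] at h2
    have := h.exp_mul_iidLaw_le (a := b) h2 (fun ω hω => by
      rw [shift_zero]; simpa using hω.2)
    rwa [zero_add, zero_add, changeLaw_one] at this
  rw [Real.exp_neg, ENNReal.ofReal_inv_of_pos (Real.exp_pos b), ← one_div,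
    ENNReal.le_div_iff_mul_le (by simp [Real.exp_pos]) (by simp), mul_comm]
  exact h1

-- The stopped walk is at most -b after a lower exit, equals b plus the overshoot after an upper
-- exit, and is below b if the test is still running.
omit [MeasurableSpace X] in
lemma sprtSum_llRatio_le {b : ℝ} (hb : 0 < b) {N : ℕ} (ω : ℕ → X) :
    sprtSum q₀ q₁ (-b) b (llRatio q₀ q₁) N ω
      ≤ -b + 2 * b * ((sprtAccept q₀ q₁ (-b) b N).indicator 1 ω
          + {ω | (N : ℕ∞) < sprtTime q₀ q₁ (-b) b ω}.indicator 1 ω)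
        + overshoot q₀ q₁ (-b) b ω := by
  have ho := overshoot_nonneg (q₀ := q₀) (q₁ := q₁) (-b) b ω
  have hG : (0 : ℝ) ≤ (sprtAccept q₀ q₁ (-b) b N).indicator 1 ω :=
    Set.indicator_nonneg (fun _ _ => zero_le_one) ω
  rcases lt_or_ge (N : ℕ∞) (sprtTime q₀ q₁ (-b) b ω) with hN | hN
  · rw [sprtSum_of_le _ hN.le, ← llrWalk_eq, Set.indicator_of_mem
      (show ω ∈ {ω | (N : ℕ∞) < sprtTime q₀ q₁ (-b) b ω} from hN), Pi.one_apply]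
    have := (llrWalk_mem_of_lt (neg_lt_zero.2 hb) hb hN).2
    nlinarith
  · have hU : ω ∉ {ω | (N : ℕ∞) < sprtTime q₀ q₁ (-b) b ω} := not_lt.2 hN
    obtain ⟨n, hn⟩ := ENat.ne_top_iff_exists.1
      (ne_top_of_le_ne_top (ENat.natCast_ne_top N) hN)
    have hnN : n ≤ N := by rw [← hn] at hN; exact_mod_cast hN
    obtain ⟨hv, hmem⟩ := llrWalk_notMem_of_eq hn.symm
    rw [sprtSum_of_eq _ hnN hn.symm, ← llrWalk_eq, Set.indicator_of_notMem hU]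
    by_cases hbn : b ≤ llrWalk q₀ q₁ n ω
    · have hA : ω ∈ {ω | b ≤ sprtValue q₀ q₁ (-b) b ω} := by
        rw [Set.mem_ofPred_eq, hv]; exact hbn
      have hY : ω ∈ sprtAccept q₀ q₁ (-b) b N :=
        Set.mem_biUnion (Finset.mem_coe.2 (Finset.mem_range.2 (Nat.lt_succ_of_le hnN)))
          ⟨hn.symm, hbn⟩
      rw [Set.indicator_of_mem hY, overshoot, Set.indicator_of_mem hA, hv, Pi.one_apply]
      linarith
    · have : llrWalk q₀ q₁ n ω ≤ -b := by
        by_contra hcon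
        exact hmem ⟨not_le.1 hcon, not_le.1 hbn⟩
      nlinarith

/-- Wald's identity applied to `sprtSum_llRatio_le`. Used twice: it bounds the mean duration from
above and then, the duration being nonnegative, the acceptance probability from below. -/
lemma RegularPair.kl_mul_sum_le (h : RegularPair ν q₀ q₁) {b : ℝ} (hb : 0 < b)
    (hD : 0 < (kl ν q₁ q₀).toReal)
    (hos : condMean (iidLaw ν q₁) (fun ω => sprtValue q₀ q₁ (-b) b ω - b)
      {ω | b ≤ sprtValue q₀ q₁ (-b) b ω} ≤ 1) (N : ℕ) :
    (kl ν q₁ q₀).toReal * ∑ j ∈ Finset.range N,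
        (iidLaw ν q₁).real {ω | (j : ℕ∞) < sprtTime q₀ q₁ (-b) b ω}
      ≤ -b + 2 * b * ((iidLaw ν q₁).real (sprtAccept q₀ q₁ (-b) b N)
        + (iidLaw ν q₁).real {ω | (N : ℕ∞) < sprtTime q₀ q₁ (-b) b ω}) + 1 := by
  have := isProbabilityMeasure_iidLaw h.pdf₁
  have ha : -b < 0 := neg_lt_zero.2 hb
  obtain ⟨h1, h2⟩ := h.integral_llRatio_right
  obtain ⟨h3, h4⟩ := h.integral_sprtSum (-b) b h.measurable_llRatio h1 N
  have hG := measurableSet_obs (h.measurableSet_sprtAccept (-b) b N)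
  have hU := measurable_stopping (h.isStoppingTime_sprtTime (-b) b) N
  have i1 := (integrable_const (μ := iidLaw ν q₁) (1 : ℝ)).indicator hG
  have i2 := (integrable_const (μ := iidLaw ν q₁) (1 : ℝ)).indicator hU
  have i3 := (i1.add i2).const_mul (2 * b)
  have i4 := (integrable_const (μ := iidLaw ν q₁) (-b)).add i3
  have i5 := h.integrable_overshoot ha hb hD
  rw [← h2, ← h4]
  refine (integral_mono h3 (i4.add i5) fun ω => sprtSum_llRatio_le hb ω).trans ?_
  rw [integral_add' i4 i5, integral_add' (integrable_const _) i3, integral_const_mul,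
    integral_add' i1 i2, integral_indicator hG, integral_indicator hU]
  simp only [integral_const, measureReal_restrict_apply_univ, probReal_univ, smul_eq_mul, mul_one, one_mul]
  have := h.integral_overshoot_le hos
  linarith

lemma RegularPair.kl_le_of_overshoot (h : RegularPair ν q₀ q₁) {b : ℝ} (hb : 0 < b)
    (hD : 0 < (kl ν q₁ q₀).toReal)
    (hos : condMean (iidLaw ν q₁) (fun ω => sprtValue q₀ q₁ (-b) b ω - b)
      {ω | b ≤ sprtValue q₀ q₁ (-b) b ω} ≤ 1) (N : ℕ) :
    (kl ν q₁ q₀).toReal * ∑ j ∈ Finset.range N,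
        (iidLaw ν q₁).real {ω | (j : ℕ∞) < sprtTime q₀ q₁ (-b) b ω} ≤ b + 1 := by
  have := isProbabilityMeasure_iidLaw h.pdf₁
  have h1 := h.kl_mul_sum_le hb hD hos N
  have hd : Disjoint (sprtAccept q₀ q₁ (-b) b N)
      {ω | (N : ℕ∞) < sprtTime q₀ q₁ (-b) b ω} := by
    refine Set.disjoint_left.2 fun ω hω hω' => ?_
    simp only [sprtAccept, Set.mem_iUnion] at hω
    obtain ⟨n, hn, hω, -⟩ := hω
    rw [Set.mem_ofPred_eq, hω] at hω'
    have h2 : N < n := by exact_mod_cast hω'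
    have := Finset.mem_range.1 hn
    omega
  have hU := measurable_stopping (h.isStoppingTime_sprtTime (-b) b) N
  rw [← measureReal_union hd hU] at h1
  have h2 : (iidLaw ν q₁).real (sprtAccept q₀ q₁ (-b) b N ∪
    {ω | (N : ℕ∞) < sprtTime q₀ q₁ (-b) b ω}) ≤ 1 := measureReal_le_one
  nlinarith

/-- The test takes at least one observation. The bound later absorbs the rounding of the block
length. -/
lemma RegularPair.kl_le (h : RegularPair ν q₀ q₁) {b : ℝ} (hb : 0 < b)
    (hD : 0 < (kl ν q₁ q₀).toReal)
    (hos : condMean (iidLaw ν q₁) (fun ω => sprtValue q₀ q₁ (-b) b ω - b)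
      {ω | b ≤ sprtValue q₀ q₁ (-b) b ω} ≤ 1) :
    (kl ν q₁ q₀).toReal ≤ b + 1 := by
  have := isProbabilityMeasure_iidLaw h.pdf₁
  have h1 := h.kl_le_of_overshoot hb hD hos 1
  have h2 : {ω : ℕ → X | ((0 : ℕ) : ℕ∞) < sprtTime q₀ q₁ (-b) b ω} = Set.univ := by
    refine Set.eq_univ_of_forall fun ω => ?_
    exact lt_of_lt_of_le (by simp) (one_le_sprtTime q₀ q₁ (-b) b ω)
  rwa [Finset.sum_range_one, h2, probReal_univ, mul_one] at h1

/-- The power of the test with a number of observations of order `1 / D(q₁‖q₀)`. -/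
lemma RegularPair.le_iidLaw_sprtAccept (h : RegularPair ν q₀ q₁) {b : ℝ} (hb : 4 ≤ b)
    (hD : 0 < (kl ν q₁ q₀).toReal)
    (hos : condMean (iidLaw ν q₁) (fun ω => sprtValue q₀ q₁ (-b) b ω - b)
      {ω | b ≤ sprtValue q₀ q₁ (-b) b ω} ≤ 1) {N : ℕ}
    (hN : 8 * (b + 1) ≤ N * (kl ν q₁ q₀).toReal) :
    ENNReal.ofReal (1 / 4) ≤ iidLaw ν q₁ (sprtAccept q₀ q₁ (-b) b N) := by
  have := isProbabilityMeasure_iidLaw h.pdf₁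
  have hb0 : 0 < b := by linarith
  set D := (kl ν q₁ q₀).toReal
  set P := iidLaw ν q₁
  have h1 := h.kl_mul_sum_le hb0 hD hos N
  have h2 := h.kl_le_of_overshoot hb0 hD hos N
  have h3 : (0 : ℝ) ≤ ∑ j ∈ Finset.range N,
      P.real {ω | (j : ℕ∞) < sprtTime q₀ q₁ (-b) b ω} :=
    Finset.sum_nonneg fun _ _ => measureReal_nonneg
  have h4 : N * P.real {ω | (N : ℕ∞) < sprtTime q₀ q₁ (-b) b ω} ≤ ∑ j ∈ Finset.range N,
      P.real {ω | (j : ℕ∞) < sprtTime q₀ q₁ (-b) b ω} := by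
    have := Finset.card_nsmul_le_sum (Finset.range N)
      (fun j => P.real {ω | (j : ℕ∞) < sprtTime q₀ q₁ (-b) b ω})
      (P.real {ω | (N : ℕ∞) < sprtTime q₀ q₁ (-b) b ω}) fun j hj => by
        refine measureReal_mono fun ω (hω : (N : ℕ∞) < sprtTime q₀ q₁ (-b) b ω) => ?_
        exact lt_trans (Nat.cast_lt.2 (Finset.mem_range.1 hj)) hω
    simpa using this
  set u := P.real {ω | (N : ℕ∞) < sprtTime q₀ q₁ (-b) b ω}
  have hu : 0 ≤ u := measureReal_nonneg
  -- N · u is at most the mean truncated duration, itself at most (b + 1)/D, while N ≥ 8(b + 1)/D.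
  have hu8 : u ≤ 1 / 8 := by
    have h5 : N * D * u ≤ b + 1 := by
      calc N * D * u = D * (N * u) := by ring
        _ ≤ _ := (mul_le_mul_of_nonneg_left h4 hD.le).trans h2
    have h6 : 8 * (b + 1) * u ≤ b + 1 := (mul_le_mul_of_nonneg_right hN hu).trans h5
    nlinarith
  refine ENNReal.ofReal_le_of_le_toReal ?_
  change 1 / 4 ≤ P.real (sprtAccept q₀ q₁ (-b) b N)
  have h7 : 0 ≤ D * ∑ j ∈ Finset.range N,
      P.real {ω | (j : ℕ∞) < sprtTime q₀ q₁ (-b) b ω} := mul_nonneg hD.le h3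
  -- From 0 ≤ -b + 2b(p + 1/8) + 1 and b ≥ 4 follows p ≥ 1/2 - 1/8 - 1/8 = 1/4.
  by_contra hcon
  rw [not_le] at hcon
  nlinarith

end Sprt

/-! ### Bounds for the optimal delay and the total damage -/

section Damage

variable {X : Type*} [MeasurableSpace X] {ν : Measure X} {q₀ q₁ : X → ℝ}

/-- With `K` blocks, e^(bK) ≥ 1 + γD pays for the false alarms, and the delay factor K(1 + 4^K) ≤ 2
· 16^K is a power of 1 + γD whose exponent shrinks as `b` grows. -/
lemma RegularPair.optDelay_le (h : RegularPair ν q₀ q₁) {b : ℝ} (hb : 4 ≤ b)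
    (hD : 0 < (kl ν q₁ q₀).toReal)
    (hos : condMean (iidLaw ν q₁) (fun ω => sprtValue q₀ q₁ (-b) b ω - b)
      {ω | b ≤ sprtValue q₀ q₁ (-b) b ω} ≤ 1) {γ : ℝ} (hγ : 0 < γ) :
    (optDelay ν q₀ q₁ γ).toReal ≤ 288 * (b + 1) *
      (1 + γ * (kl ν q₁ q₀).toReal) ^ (Real.log 16 / b) / (kl ν q₁ q₀).toReal := by
  have hb0 : 0 < b := by linarith
  have hDle := h.kl_le hb0 hD hos
  set D := (kl ν q₁ q₀).toReal
  have hx : 0 < γ * D := mul_pos hγ hD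
  have hlog : 0 < Real.log (1 + γ * D) := Real.log_pos (by linarith)
  set m := ⌈8 * (b + 1) / D⌉₊
  set K := ⌈Real.log (1 + γ * D) / b⌉₊
  have hm1 : 8 * (b + 1) / D ≤ m := Nat.le_ceil _
  have hm2 : (m : ℝ) ≤ 9 * (b + 1) / D := by
    have h1 : (m : ℝ) < 8 * (b + 1) / D + 1 := Nat.ceil_lt_add_one (by positivity)
    have h2 : 1 ≤ (b + 1) / D := (one_le_div hD).2 hDle
    have h3 : 9 * (b + 1) / D = 8 * (b + 1) / D + (b + 1) / D := by ring
    linarith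
  have hm0 : 0 < m := Nat.ceil_pos.2 (by positivity)
  have hK0 : 0 < K := Nat.ceil_pos.2 (by positivity)
  have hK1 : Real.log (1 + γ * D) / b ≤ K := Nat.le_ceil _
  have hK2 : (K : ℝ) < Real.log (1 + γ * D) / b + 1 := Nat.ceil_lt_add_one (by positivity)
  have hexpK : 1 + γ * D ≤ Real.exp b ^ K := by
    rw [← Real.exp_nat_mul, ← Real.exp_log (show 0 < 1 + γ * D by linarith)]
    exact Real.exp_le_exp.2 ((div_le_iff₀ hb0).1 hK1)
  have hγK : γ ≤ (K * m : ℕ) * Real.exp b ^ K := by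
    have h1 : 1 / D ≤ m := le_trans (div_le_div_of_nonneg_right (by linarith) hD.le) hm1
    have h2 : (1 : ℝ) ≤ K := by exact_mod_cast hK0
    calc γ = 1 / D * (γ * D) := by field_simp
      _ ≤ m * Real.exp b ^ K := by
          refine mul_le_mul h1 (by linarith) hx.le (Nat.cast_nonneg m)
      _ ≤ (K * m : ℕ) * Real.exp b ^ K := by
          push_cast
          rw [mul_assoc]
          exact le_mul_of_one_le_left (by positivity) h2
  have h16 : (16 : ℝ) ^ K ≤ 16 * (1 + γ * D) ^ (Real.log 16 / b) := by
    have h1 : (16 : ℝ) ^ K = Real.exp (K * Real.log 16) := by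
      rw [Real.exp_nat_mul, Real.exp_log (by norm_num)]
    have h2 : 16 * (1 + γ * D) ^ (Real.log 16 / b)
        = Real.exp ((Real.log (1 + γ * D) / b + 1) * Real.log 16) := by
      rw [add_mul, one_mul, Real.exp_add, Real.exp_log (by norm_num),
        Real.rpow_def_of_pos (by linarith), mul_comm]
      congr 2
      ring
    rw [h1, h2]
    exact Real.exp_le_exp.2 (mul_le_mul_of_nonneg_right hK2.le (Real.log_nonneg (by norm_num)))
  have hmain := optDelay_le_of_test (γ := γ) h.pdf₀ h.pdf₁ hm0 hK0
    (h.measurableSet_sprtAccept (-b) b m) (h.iidLaw_sprtAccept_le (-b) b m)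
    (h.le_iidLaw_sprtAccept hb hD hos ((div_le_iff₀ hD).1 hm1)) (by
      rw [Real.exp_neg, ENNReal.ofReal_inv_of_pos (Real.exp_pos b), ENNReal.inv_pow, inv_inv,
        ← ENNReal.ofReal_pow (Real.exp_pos b).le, ← ENNReal.ofReal_natCast,
        ← ENNReal.ofReal_mul (Nat.cast_nonneg _)]
      exact ENNReal.ofReal_le_ofReal hγK)
  have h4 : ((ENNReal.ofReal (1 / 4)) ^ K)⁻¹ = ENNReal.ofReal (4 ^ K) := by
    rw [one_div, ENNReal.ofReal_inv_of_pos (by norm_num), ENNReal.inv_pow, inv_inv,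
      ← ENNReal.ofReal_pow (by norm_num)]
  rw [h4, ← ENNReal.ofReal_natCast, ← ENNReal.ofReal_mul (Nat.cast_nonneg _),
    ← ENNReal.ofReal_add (Nat.cast_nonneg _) (by positivity)] at hmain
  refine (ENNReal.toReal_le_of_le_ofReal (by positivity) hmain).trans ?_
  have hK4 : (K : ℝ) ≤ 4 ^ K := by exact_mod_cast (Nat.lt_pow_self (by norm_num)).le
  have h14 : (1 : ℝ) ≤ 4 ^ K := one_le_pow₀ (by norm_num)
  have h416 : (4 : ℝ) ^ K * 4 ^ K = 16 ^ K := by rw [← mul_pow]; norm_num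
  -- The constant is 288 = 9 · 2 · 16: block length, K(1 + 4^K) ≤ 2 · 16^K, and rounding of `K`.
  calc ((K * m : ℕ) : ℝ) + (K * m : ℕ) * 4 ^ K = m * (K * (1 + 4 ^ K)) := by push_cast; ring
    _ ≤ m * (4 ^ K * (2 * 4 ^ K)) := by
        gcongr
        linarith
    _ = m * (2 * 16 ^ K) := by rw [← h416]; ring
    _ ≤ (9 * (b + 1) / D) * (2 * (16 * (1 + γ * D) ^ (Real.log 16 / b))) := by gcongr
    _ = _ := by ring

lemma optDelay_ne_top (h₀ : IsPDF ν q₀) (h₁ : IsPDF ν q₁) (γ : ℝ) :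
    optDelay ν q₀ q₁ γ ≠ ∞ :=
  ne_top_of_le_ne_top (ENNReal.natCast_ne_top _) (optDelay_le_ceil h₀ h₁ γ)

lemma toReal_optDelay_le (h₀ : IsPDF ν q₀) (h₁ : IsPDF ν q₁) {γ : ℝ} (hγ : 1 ≤ γ) :
    (optDelay ν q₀ q₁ γ).toReal ≤ 2 * γ := by
  have h1 := ENNReal.toReal_mono (ENNReal.natCast_ne_top _) (optDelay_le_ceil h₀ h₁ γ)
  rw [ENNReal.toReal_natCast] at h1
  linarith [Nat.ceil_lt_add_one (show 0 ≤ γ by linarith)]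

lemma RegularPair.le_toReal_optDelay (h : RegularPair ν q₀ q₁) {γ η : ℝ} (hη : 0 < η)
    (hη3 : η ≤ 1 / 3) (hγ : 2 ≤ η * γ) (hD : η * (γ * (kl ν q₀ q₁).toReal) ≤ 1 / 4) :
    η / 64 * γ ≤ (optDelay ν q₀ q₁ γ).toReal := by
  have hγ0 : 0 < γ := by
    by_contra hcon
    nlinarith
  have h1 : (⌊η * γ⌋₊ : ℝ) ≤ η * γ := Nat.floor_le (by linarith)
  have h2 : η * γ < ⌊η * γ⌋₊ + 1 := Nat.lt_floor_add_one _
  -- As ηγ ≥ 2, the floor is at least ηγ/2, whence 64 = 2 · 32; η ≤ 1/3 gives 2m < γ.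
  have h3 := h.le_optDelay (γ := γ) (m := ⌊η * γ⌋₊) (Nat.floor_pos.2 (by linarith)) (by
    refine (mul_le_mul_of_nonneg_right h1 ENNReal.toReal_nonneg).trans ?_
    linarith) (by nlinarith)
  have h4 := ENNReal.toReal_mono
    (ENNReal.mul_ne_top (by simp) (optDelay_ne_top h.pdf₀ h.pdf₁ γ)) h3
  rw [ENNReal.toReal_natCast, ENNReal.toReal_mul, ENNReal.toReal_ofNat] at h4
  linarith

lemma rpow_div_mul_self {y γ s : ℝ} (hy : 0 ≤ y) (hγ : 0 < γ) :
    γ * (y / γ) ^ s = y ^ s * γ ^ (1 - s) := by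
  rw [Real.div_rpow hy hγ.le, Real.rpow_sub hγ, Real.rpow_one]
  field_simp

variable {q : X → ℝ} {qf : ℝ → X → ℝ} {ρ : ℝ}

lemma totalDamage_nonneg (γ : ℝ) : 0 ≤ totalDamage ν (fun x => x ^ ρ) q qf γ :=
  mul_nonneg ENNReal.toReal_nonneg (Real.rpow_nonneg ENNReal.toReal_nonneg _)

/-- The bound for the damage from deterministic stopping. -/
lemma totalDamage_le_of_trivial {γ : ℝ} (hq : IsPDF ν q) (hqf : IsPDF ν (qf γ)) (hγ : 1 ≤ γ) :
    totalDamage ν (fun x => x ^ ρ) q qf γ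
      ≤ 2 * (γ * (kl ν q (qf γ)).toReal) ^ ρ * γ ^ (1 - ρ) := by
  have hγ0 : 0 < γ := by linarith
  have hD : 0 ≤ (kl ν q (qf γ)).toReal := ENNReal.toReal_nonneg
  calc totalDamage ν (fun x => x ^ ρ) q qf γ
      ≤ 2 * γ * (kl ν q (qf γ)).toReal ^ ρ :=
        mul_le_mul_of_nonneg_right (toReal_optDelay_le hq hqf hγ) (Real.rpow_nonneg hD _)
    _ = 2 * (γ * (γ * (kl ν q (qf γ)).toReal / γ) ^ ρ) := by
        rw [mul_div_cancel_left₀ _ hγ0.ne']; ring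
    _ = _ := by rw [rpow_div_mul_self (mul_nonneg hγ0.le hD) hγ0]; ring

/-- The bound for the damage from repeated sequential tests. -/
lemma RegularPair.totalDamage_le {γ b c : ℝ} (h : RegularPair ν q (qf γ)) (hγ : 0 < γ)
    (hρ1 : ρ < 1) (hb : 4 ≤ b) (hbρ : Real.log 16 / b ≤ (1 - ρ) / 2) (hc : 0 < c)
    (hD : 0 < (kl ν (qf γ) q).toReal)
    (hos : condMean (iidLaw ν (qf γ)) (fun ω => sprtValue q (qf γ) (-b) b ω - b)
      {ω | b ≤ sprtValue q (qf γ) (-b) b ω} ≤ 1)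
    (hr1 : c / 2 * (kl ν (qf γ) q).toReal ≤ (kl ν q (qf γ)).toReal)
    (hr2 : (kl ν q (qf γ)).toReal ≤ 2 * c * (kl ν (qf γ) q).toReal)
    (hy : 1 ≤ γ * (kl ν q (qf γ)).toReal) :
    totalDamage ν (fun x => x ^ ρ) q qf γ
      ≤ 576 * (b + 1) * c * (1 + 2 / c) ^ ((1 - ρ) / 2) *
        (γ * (kl ν q (qf γ)).toReal) ^ (-((1 - ρ) / 2)) * γ ^ (1 - ρ) := by
  have h1 := h.optDelay_le hb hD hos hγ
  set D' := (kl ν (qf γ) q).toReal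
  set D := (kl ν q (qf γ)).toReal
  set y := γ * D
  have hb0 : 0 < b := by linarith
  have hy0 : 0 < y := by linarith
  have hD0 : 0 < D := by
    by_contra hcon
    nlinarith
  have hDy : D = y / γ := by simp only [y]; field_simp
  have hpow : (1 + γ * D') ^ (Real.log 16 / b)
      ≤ (1 + 2 / c) ^ ((1 - ρ) / 2) * y ^ ((1 - ρ) / 2) := by
    rw [← Real.mul_rpow (by positivity) hy0.le]
    have h2 : 1 + γ * D' ≤ (1 + 2 / c) * y := by
      have h3 : D' ≤ 2 / c * D := by
        calc D' = 2 / c * (c / 2 * D') := by field_simp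
          _ ≤ 2 / c * D := by gcongr
      have h4 : γ * D' ≤ 2 / c * y := by
        calc γ * D' ≤ γ * (2 / c * D) := by gcongr
          _ = 2 / c * y := by simp only [y]; ring
      linarith
    have h5 : 1 ≤ 1 + γ * D' := by nlinarith
    calc (1 + γ * D') ^ (Real.log 16 / b) ≤ (1 + γ * D') ^ ((1 - ρ) / 2) :=
          Real.rpow_le_rpow_of_exponent_le h5 hbρ
      _ ≤ _ := Real.rpow_le_rpow (by linarith) h2 (by linarith)
  have hinv : 1 / D' ≤ 2 * c / D := by
    rw [div_le_div_iff₀ hD hD0]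
    linarith
  -- Half of the decay y^(ρ-1) is spent on the delay factor; the other half remains.
  have hyy : y ^ ((1 - ρ) / 2) * y ^ (ρ - 1) = y ^ (-((1 - ρ) / 2)) := by
    rw [← Real.rpow_add hy0]
    congr 1
    ring
  have hDD : 1 / D * D ^ ρ = y ^ (ρ - 1) * γ ^ (1 - ρ) := by
    have h6 : 1 / D * D ^ ρ = D ^ (ρ - 1) := by
      rw [Real.rpow_sub hD0, Real.rpow_one]; ring
    rw [h6, hDy, Real.div_rpow hy0.le hγ.le, ← neg_sub 1 ρ, Real.rpow_neg hγ.le, div_inv_eq_mul]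
  calc totalDamage ν (fun x => x ^ ρ) q qf γ
      ≤ (288 * (b + 1) * (1 + γ * D') ^ (Real.log 16 / b) / D') * D ^ ρ :=
        mul_le_mul_of_nonneg_right h1 (Real.rpow_nonneg hD0.le _)
    _ = 288 * (b + 1) * (1 + γ * D') ^ (Real.log 16 / b) * (1 / D') * D ^ ρ := by ring
    _ ≤ 288 * (b + 1) * ((1 + 2 / c) ^ ((1 - ρ) / 2) * y ^ ((1 - ρ) / 2)) * (2 * c / D)
          * D ^ ρ := by gcongr
    _ = 576 * (b + 1) * c * (1 + 2 / c) ^ ((1 - ρ) / 2) * y ^ ((1 - ρ) / 2)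
          * (1 / D * D ^ ρ) := by ring
    _ = 576 * (b + 1) * c * (1 + 2 / c) ^ ((1 - ρ) / 2) * (y ^ ((1 - ρ) / 2) * y ^ (ρ - 1))
          * γ ^ (1 - ρ) := by rw [hDD]; ring
    _ = _ := by rw [hyy]

lemma RegularPair.le_totalDamage {γ η : ℝ} (h : RegularPair ν q (qf γ)) (hη : 0 < η)
    (hη3 : η ≤ 1 / 3) (hγ0 : 0 < γ) (hγ : 2 ≤ η * γ)
    (hD : η * (γ * (kl ν q (qf γ)).toReal) ≤ 1 / 4) :
    η / 64 * (γ * (kl ν q (qf γ)).toReal) ^ ρ * γ ^ (1 - ρ)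
      ≤ totalDamage ν (fun x => x ^ ρ) q qf γ := by
  have hD0 : 0 ≤ (kl ν q (qf γ)).toReal := ENNReal.toReal_nonneg
  calc η / 64 * (γ * (kl ν q (qf γ)).toReal) ^ ρ * γ ^ (1 - ρ)
      = η / 64 * (γ * (γ * (kl ν q (qf γ)).toReal / γ) ^ ρ) := by
        rw [rpow_div_mul_self (mul_nonneg hγ0.le hD0) hγ0]; ring
    _ = η / 64 * γ * (kl ν q (qf γ)).toReal ^ ρ := by
        rw [mul_div_cancel_left₀ _ hγ0.ne']; ring
    _ ≤ _ := mul_le_mul_of_nonneg_right (h.le_toReal_optDelay hη hη3 hγ hD)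
        (Real.rpow_nonneg hD0 _)

/-- The two bounds for the damage hold for all large `γ`. -/
lemma exists_eventually_totalDamage_le (hreg : ∀ γ : ℝ, 0 < γ → RegularPair ν q (qf γ))
    (hos : VanishingOvershoot ν q qf qf) {c : ℝ} (hc : 0 < c)
    (hratio : Tendsto (fun γ : ℝ => (kl ν q (qf γ)).toReal / (kl ν (qf γ) q).toReal)
      atTop (𝓝 c)) (hρ1 : ρ < 1) :
    ∃ B : ℝ, 0 < B ∧ ∀ᶠ γ : ℝ in atTop, 1 ≤ γ * (kl ν q (qf γ)).toReal →
      totalDamage ν (fun x => x ^ ρ) q qf γ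
        ≤ B * (γ * (kl ν q (qf γ)).toReal) ^ (-((1 - ρ) / 2)) * γ ^ (1 - ρ) := by
  -- 4 is needed for the power of the test, the other term for log 16/b ≤ (1 - ρ)/2.
  set b := max 4 (2 * Real.log 16 / (1 - ρ))
  have hb : 4 ≤ b := le_max_left _ _
  have hb0 : 0 < b := by linarith
  have hρ : 0 < 1 - ρ := by linarith
  have hbρ : Real.log 16 / b ≤ (1 - ρ) / 2 := by
    have : 2 * Real.log 16 / (1 - ρ) ≤ b := le_max_right _ _
    rw [div_le_iff₀ hρ] at this
    rw [div_le_iff₀ hb0]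
    linarith
  refine ⟨576 * (b + 1) * c * (1 + 2 / c) ^ ((1 - ρ) / 2), by positivity, ?_⟩
  filter_upwards [eventually_gt_atTop (0 : ℝ),
    ((hos (-b) b (by linarith) hb0).1.eventually (ge_mem_nhds zero_lt_one)),
    hratio.eventually (lt_mem_nhds (show c / 2 < c by linarith)),
    hratio.eventually (gt_mem_nhds (show c < 2 * c by linarith))] with γ hγ h1 h2 h3 hy
  -- A zero denominator would make the ratio 0 by convention, below c/2.
  have hD : 0 < (kl ν (qf γ) q).toReal := by
    rcases (ENNReal.toReal_nonneg (a := kl ν (qf γ) q)).eq_or_lt with h0 | h0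
    · rw [← h0, div_zero] at h2
      linarith
    · exact h0
  exact (hreg γ hγ).totalDamage_le hγ hρ1 hb hbρ hc hD h1 ((lt_div_iff₀ hD).1 h2).le
    ((div_lt_iff₀ hD).1 h3).le hy

/-- Sequential tests serve for γD ≥ 1 and deterministic stopping for γD ≤ 1, so no limiting regime
is needed. -/
lemma totalDamage_isBigO (hreg : ∀ γ : ℝ, 0 < γ → RegularPair ν q (qf γ)) (hρ0 : 0 < ρ)
    (hρ1 : ρ < 1) {B : ℝ} (hB : 0 < B)
    (hbd : ∀ᶠ γ : ℝ in atTop, 1 ≤ γ * (kl ν q (qf γ)).toReal →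
      totalDamage ν (fun x => x ^ ρ) q qf γ
        ≤ B * (γ * (kl ν q (qf γ)).toReal) ^ (-((1 - ρ) / 2)) * γ ^ (1 - ρ)) :
    totalDamage ν (fun x => x ^ ρ) q qf =O[atTop] fun γ : ℝ => γ ^ (1 - ρ) := by
  refine IsBigO.of_bound (B + 2) ?_
  filter_upwards [eventually_ge_atTop (1 : ℝ), hbd] with γ hγ h1
  have hγ0 : 0 < γ := by linarith
  have hp : 0 < γ ^ (1 - ρ) := Real.rpow_pos_of_pos hγ0 _
  rw [Real.norm_of_nonneg (totalDamage_nonneg γ), Real.norm_of_nonneg hp.le]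
  rcases le_total 1 (γ * (kl ν q (qf γ)).toReal) with hy | hy
  · refine (h1 hy).trans (mul_le_mul_of_nonneg_right ?_ hp.le)
    have := Real.rpow_le_one_of_one_le_of_nonpos hy
      (show -((1 - ρ) / 2) ≤ 0 by linarith)
    nlinarith
  · refine (totalDamage_le_of_trivial (hreg γ hγ0).pdf₀ (hreg γ hγ0).pdf₁ hγ).trans
      (mul_le_mul_of_nonneg_right ?_ hp.le)
    have := Real.rpow_le_one (mul_nonneg hγ0.le ENNReal.toReal_nonneg) hy hρ0.le
    linarith

lemma totalDamage_isLittleO_of_le {f : ℝ → ℝ} (hf : Tendsto f atTop (𝓝 0))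
    (h : ∀ᶠ γ : ℝ in atTop, totalDamage ν (fun x => x ^ ρ) q qf γ ≤ f γ * γ ^ (1 - ρ)) :
    totalDamage ν (fun x => x ^ ρ) q qf =o[atTop] fun γ : ℝ => γ ^ (1 - ρ) := by
  refine IsLittleO.of_bound fun ε hε => ?_
  filter_upwards [eventually_gt_atTop (0 : ℝ), h, hf.eventually (gt_mem_nhds hε)]
    with γ hγ h1 h2
  have hp : 0 < γ ^ (1 - ρ) := Real.rpow_pos_of_pos hγ _
  rw [Real.norm_of_nonneg (totalDamage_nonneg γ), Real.norm_of_nonneg hp.le]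
  exact h1.trans (mul_le_mul_of_nonneg_right h2.le hp.le)

lemma isBigO_totalDamage (hreg : ∀ γ : ℝ, 0 < γ → RegularPair ν q (qf γ)) (hρ0 : 0 < ρ)
    (hΘ : (fun γ : ℝ => γ * (kl ν q (qf γ)).toReal) =Θ[atTop] (fun _ : ℝ => (1 : ℝ))) :
    (fun γ : ℝ => γ ^ (1 - ρ)) =O[atTop] totalDamage ν (fun x => x ^ ρ) q qf := by
  obtain ⟨C, hC, h1⟩ := hΘ.1.exists_pos
  obtain ⟨C', hC', h2⟩ := hΘ.2.exists_pos
  set η := min (1 / 3) (1 / (4 * C))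
  have hη : 0 < η := by positivity
  have hη3 : η ≤ 1 / 3 := min_le_left _ _
  have hηC : η * C ≤ 1 / 4 := by
    calc η * C ≤ 1 / (4 * C) * C := by gcongr; exact min_le_right _ _
      _ = 1 / 4 := by field_simp
  refine IsBigO.of_bound (64 / η * C' ^ ρ) ?_
  filter_upwards [eventually_gt_atTop (0 : ℝ), eventually_ge_atTop (2 / η), h1.bound, h2.bound]
    with γ hγ0 hγ hy1 hy2
  have hp : 0 < γ ^ (1 - ρ) := Real.rpow_pos_of_pos hγ0 _
  have hy0 : 0 ≤ γ * (kl ν q (qf γ)).toReal := mul_nonneg hγ0.le ENNReal.toReal_nonneg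
  rw [Real.norm_of_nonneg hy0, norm_one, mul_one] at hy1
  rw [Real.norm_of_nonneg hy0, norm_one] at hy2
  rw [Real.norm_of_nonneg (totalDamage_nonneg γ), Real.norm_of_nonneg hp.le]
  have h3 := (hreg γ hγ0).le_totalDamage (ρ := ρ) hη hη3 hγ0 ((div_le_iff₀' hη).1 hγ)
    ((mul_le_mul_of_nonneg_left hy1 hη.le).trans hηC)
  have h4 : 1 ≤ C' ^ ρ * (γ * (kl ν q (qf γ)).toReal) ^ ρ := by
    rw [← Real.mul_rpow hC'.le hy0]
    exact Real.one_le_rpow hy2 hρ0.le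
  calc γ ^ (1 - ρ) ≤ C' ^ ρ * (γ * (kl ν q (qf γ)).toReal) ^ ρ * γ ^ (1 - ρ) :=
        le_mul_of_one_le_left hp.le h4
    _ = 64 / η * C' ^ ρ *
          (η / 64 * (γ * (kl ν q (qf γ)).toReal) ^ ρ * γ ^ (1 - ρ)) := by field_simp
    _ ≤ _ := by gcongr

end Damage

end QuickestChange

theorem mainTheorem6 {X : Type*} [MeasurableSpace X] (ν : Measure X) [SigmaFinite ν]
    (q : X → ℝ) (qf : ℝ → X → ℝ)
    -- pre- and post-change densities
    (hq : QuickestChange.IsPDF ν q)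
    (hqf : ∀ γ : ℝ, 0 < γ → QuickestChange.IsPDF ν (qf γ))
    (hlim : ∀ᵐ x ∂ν, Tendsto (fun γ : ℝ => qf γ x) atTop (𝓝 (q x)))
    (hne : ∀ γ : ℝ, 0 < γ → ¬ (qf γ =ᵐ[ν] q))
    -- the log-likelihood ratio is almost surely finite under both densities
    (hfin_q : ∀ γ : ℝ, 0 < γ → ∀ᵐ x ∂(QuickestChange.obsDist ν q), 0 < q x ∧ 0 < qf γ x)
    (hfin_qf : ∀ γ : ℝ, 0 < γ → ∀ᵐ x ∂(QuickestChange.obsDist ν (qf γ)), 0 < q x ∧ 0 < qf γ x)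
    -- both divergences are finite
    (hkl : ∀ γ : ℝ, 0 < γ → QuickestChange.kl ν q (qf γ) ≠ ∞)
    (hkl' : ∀ γ : ℝ, 0 < γ → QuickestChange.kl ν (qf γ) q ≠ ∞)
    -- the expected overshoots vanish under both densities
    (hos_q : QuickestChange.VanishingOvershoot ν q qf (fun _ => q))
    (hos_qf : QuickestChange.VanishingOvershoot ν q qf qf)
    (c : ℝ) (hc : 0 < c)
    (hratio : Tendsto
      (fun γ : ℝ => (QuickestChange.kl ν q (qf γ)).toReal / (QuickestChange.kl ν (qf γ) q).toReal)
      atTop (𝓝 c))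
    (ρ : ℝ) (hρ0 : 0 < ρ) (hρ1 : ρ < 1) :
    -- the optimal delay is finite
    (∀ γ : ℝ, 0 < γ → QuickestChange.optDelay ν q (qf γ) γ ≠ ∞) ∧
    -- in every regime the order of the damage is at most `γ ^ (1 - ρ)`
    (QuickestChange.totalDamage ν (fun x => x ^ ρ) q qf
      =O[atTop] fun γ : ℝ => γ ^ (1 - ρ)) ∧
    -- this order is reached when `γ D(q‖q_γ) = Θ(1)`
    ((fun γ : ℝ => γ * (QuickestChange.kl ν q (qf γ)).toReal) =Θ[atTop] (fun _ : ℝ => (1 : ℝ)) →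
      QuickestChange.totalDamage ν (fun x => x ^ ρ) q qf
        =Θ[atTop] fun γ : ℝ => γ ^ (1 - ρ)) ∧
    -- and it is not reached when `γ D(q‖q_γ)` tends to infinity or to zero
    (Tendsto (fun γ : ℝ => γ * (QuickestChange.kl ν q (qf γ)).toReal) atTop atTop →
      QuickestChange.totalDamage ν (fun x => x ^ ρ) q qf
        =o[atTop] fun γ : ℝ => γ ^ (1 - ρ)) ∧
    (Tendsto (fun γ : ℝ => γ * (QuickestChange.kl ν q (qf γ)).toReal) atTop (𝓝 0) →
      QuickestChange.totalDamage ν (fun x => x ^ ρ) q qf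
        =o[atTop] fun γ : ℝ => γ ^ (1 - ρ)) := by
  have hreg : ∀ γ : ℝ, 0 < γ → QuickestChange.RegularPair ν q (qf γ) := fun γ hγ =>
    ⟨hq, hqf γ hγ, hfin_q γ hγ, hfin_qf γ hγ, hkl γ hγ, hkl' γ hγ⟩
  obtain ⟨B, hB, hbd⟩ :=
    QuickestChange.exists_eventually_totalDamage_le hreg hos_qf hc hratio hρ1
  have hO := QuickestChange.totalDamage_isBigO hreg hρ0 hρ1 hB hbd
  refine ⟨fun γ hγ => QuickestChange.optDelay_ne_top hq (hqf γ hγ) γ, hO,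
    fun hΘ => ⟨hO, QuickestChange.isBigO_totalDamage hreg hρ0 hΘ⟩, fun hy => ?_, fun hy => ?_⟩
  · refine QuickestChange.totalDamage_isLittleO_of_le
      (f := fun γ => B * (γ * (QuickestChange.kl ν q (qf γ)).toReal) ^ (-((1 - ρ) / 2))) ?_ ?_
    · have h := (tendsto_rpow_neg_atTop (show 0 < (1 - ρ) / 2 by linarith)).comp hy
      simpa using h.const_mul B
    · filter_upwards [hbd, hy.eventually_ge_atTop 1] with γ h1 h2
      exact h1 h2
  · refine QuickestChange.totalDamage_isLittleO_of_le
      (f := fun γ => 2 * (γ * (QuickestChange.kl ν q (qf γ)).toReal) ^ ρ) ?_ ?_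
    · have h := (hy.rpow_const (Or.inr hρ0.le)).const_mul 2
      simpa [Real.zero_rpow hρ0.ne'] using h
    · filter_upwards [eventually_ge_atTop (1 : ℝ)] with γ hγ
      exact QuickestChange.totalDamage_le_of_trivial hq (hqf γ (by linarith)) hγ
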